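/- **Setting.** Let $e_n(x)=\pi^{-1/4}((n-1)!)^{-1/2}\,h_{n-1}(\sqrt2\,x)\,e^{-x^2/2}$, $n\ge 1$, be the Hermite functions ($h_k$ the probabilists' Hermite polynomials), an orthonormal basis of the complex space $\mathcal K_0=\mathbf L_2(\mathbb R,dx)$. For $p\in\mathbb Z$ let $$\mathcal K_p=\Big\{\sum_{n\ge1} f_ne_n:\ \sum_{n\ge 1}|f_n|^2\,2^{np}<\infty\Big\},$$ and let $\Gamma(\mathcal K_p)=\bigoplus_{k\ge0}\mathcal K_p^{\otimes k}$ be its full Fock space, i.e. the space of formal series $u=\sum_\alpha u_\alpha e_\alpha$ over words $\alpha=(n_1,\dots,n_k)$, $k\ge 0$, where $e_\alpha=e_{n_1}\otimes\cdots\otimes e_{n_k}$, with $\sum_\alpha |u_\alpha|^2\,2^{(n_1+\cdots+n_k)p}<\infty$. Put $$\widetilde{\mathcal G}_1=\bigcap_{p\in\mathbb N}\Gamma(\mathcal K_p)\ \subset\ \Gamma(\mathcal K_0)\ \subset\ \widetilde{\mathcal G}_{-1}=\bigcup_{p\in\mathbb N}\Gamma(\mathcal K_{-p}),$$ with the projective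 limit topology on $\widetilde{\mathcal G}_1$ and the locally convex inductive limit topology on $\widetilde{\mathcal G}_{-1}$ (which is its strong topology as the dual of $\widetilde{\mathcal G}_1$); $\mathcal L(\widetilde{\mathcal G}_1,\widetilde{\mathcal G}_{-1})$ is the space of continuous linear maps. For $h\in\bigcup_p\mathcal K_{-p}$ let $\ell_hu=h\otimes u$ and let $\ell_h^*$ be its adjoint, so that $\ell_h^*(k\otimes u)=\langle h,k\rangle u$ and $\ell_h^*$ vanishes on the vacuum (the inner product is conjugate-linear in its first argument). Write $\widehat f(u)=\int_{\mathbb R}e^{-iux}f(x)\,dx$, and $1_{[0,t]}=-1_{[t,0]}$ for $t<0$. For a measurable $m:\mathbb R\to[0,\infty)$ the operator $T_m$ is given by $\widehat{T_mf}=\sqrt m\,\widehat f$; the generalized function $T_m1_{[0,t]}$ is $\sum_n\alpha_n(t)e_n$ with $$\alpha_n(t)=\frac1{2\pi}\int_{\mathbb R}\sqrt{m(u)}\ \widehat{1_{[0,t]}}(u)\,\overline{\widehat{e_n}(u)}\,du .$$ **Theorem.** Assume that there are real numbers $b<2$, $K$, $C_1>0$, $C_2>0$ such that $$m(t)\le K|t|^{-b}\quad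 (0<|t|\le 1),\qquad m(t)\le C_1e^{C_2|t|}\quad(|t|\ge1).$$ Then: 1. For all $t\in\mathbb R$ and $n\ge 1$ the integral defining $\alpha_n(t)$ converges absolutely, and for every $t\in\mathbb R$ there is $p\in\mathbb N$ with $T_m1_{[0,t]}\in\mathcal K_{-p}$. 2. If moreover $\int_{\mathbb R}\frac{m(u)}{1+u^2}\,du<\infty$, then for every $t$ the function $1_{[0,t]}$ is in the domain of the operator $T_m$ of $\mathbf L_2(\mathbb R,dx)$, and the $\alpha_n(t)$ are the Hermite coefficients $\langle e_n,T_m1_{[0,t]}\rangle$ of its value in $\mathbf L_2(\mathbb R,dx)$. 3. For every $t\in\mathbb R$, $X_m(t)=\ell_{T_m1_{[0,t]}}+\ell^*_{T_m1_{[0,t]}}$ belongs to $\mathcal L(\widetilde{\mathcal G}_1,\widetilde{\mathcal G}_{-1})$, and there is an $\mathcal L(\widetilde{\mathcal G}_1,\widetilde{\mathcal G}_{-1})$-valued function $t\mapsto W_m(t)$ on $\mathbb R$ such that $$\frac{d}{dt}X_m(t)f=W_m(t)f\qquad\text{for all } t\in\mathbb R \text{ and } f\in\widetilde{\mathcal G}_1,$$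 the derivative being taken in the topology of $\widetilde{\mathcal G}_{-1}$. -/

import Mathlib

open MeasureTheory Filter Topology
open scoped NNReal ENNReal FourierTransform ComplexConjugate

noncomputable section

namespace FreeNoise

/-! ### Weighted `ℓ²` spaces -/

/-- The space `ℓ²(ι, w)` of complex families `u` with `∑ i, w i * |u i|² < ∞`. -/
def weightedL2 {ι : Type} (w : ι → ℝ≥0) : Submodule ℂ (ι → ℂ) where
  carrier := {u | Summable fun i => (w i : ℝ) * ‖u i‖ ^ 2}
  zero_mem' := by simp
  add_mem' := by
    intro a b ha hb
    refine Summable.of_nonneg_of_le (fun i => by positivity) (fun i => ?_)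
      ((ha.mul_left 2).add (hb.mul_left 2))
    have h1 : ‖a i + b i‖ ≤ ‖a i‖ + ‖b i‖ := norm_add_le _ _
    have h2 : ‖a i + b i‖ ^ 2 ≤ 2 * ‖a i‖ ^ 2 + 2 * ‖b i‖ ^ 2 := by
      nlinarith [norm_nonneg (a i + b i), sq_nonneg (‖a i‖ - ‖b i‖)]
    have h3 := mul_le_mul_of_nonneg_left h2 (w i).coe_nonneg
    simp only [Pi.add_apply]
    linarith
  smul_mem' := by
    intro c a ha
    refine (ha.mul_left (‖c‖ ^ 2)).congr (fun i => ?_)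
    simp only [Pi.smul_apply, smul_eq_mul, norm_mul]
    ring

theorem mem_weightedL2 {ι : Type} {w : ι → ℝ≥0} {u : ι → ℂ} :
    u ∈ weightedL2 w ↔ Summable fun i => (w i : ℝ) * ‖u i‖ ^ 2 := Iff.rfl

theorem memlp_sqrt_mul {ι : Type} {w : ι → ℝ≥0} {u : ι → ℂ} (hu : u ∈ weightedL2 w) :
    Memℓp (fun i => ((Real.sqrt (w i) : ℝ) : ℂ) * u i) 2 := by
  refine memℓp_gen ?_
  refine (mem_weightedL2.1 hu).congr (fun i => ?_)
  simp [mul_pow, Real.sq_sqrt]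

/-- The isometry `u ↦ (√(w i) * u i)` of `ℓ²(ι, w)` into the unweighted `ℓ²(ι)`. -/
def toLp2 {ι : Type} (w : ι → ℝ≥0) : weightedL2 w →ₗ[ℂ] lp (fun _ : ι => ℂ) 2 where
  toFun u := ⟨fun i => ((Real.sqrt (w i) : ℝ) : ℂ) * (u : ι → ℂ) i, memlp_sqrt_mul u.2⟩
  map_add' u v := by
    ext i
    exact mul_add _ _ _
  map_smul' c u := by
    ext i
    simp [mul_left_comm]

/-! ### The scale `K_p`, the full Fock spaces `Γ(K_p)` and the triple `G̃₁ ⊆ Γ(K_0) ⊆ G̃₋₁`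

Basis vectors are indexed from `0`: the index `n : ℕ` stands for `e_{n+1}`, whose weight is
`a_{n+1} = 2 ^ (n + 1)`.  A word `[n₁, …, n_k]` stands for the basis vector
`e_{n₁+1} ⊗ ⋯ ⊗ e_{n_k+1}` of the `k`-th tensor power, the empty word for the vacuum `Ω`. -/

/-- The weight `a_{n+1} = 2 ^ (n + 1)`. -/
def letterWeight (n : ℕ) : ℝ≥0 := 2 ^ (n + 1)

/-- `K_p = {∑ f_n e_n : ∑ |f_n|² a_n ^ p < ∞}`, as a space of coefficient sequences. -/
def K (p : ℤ) : Submodule ℂ (ℕ → ℂ) := weightedL2 fun n => letterWeight n ^ p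

/-- The weight of `e_{n₁+1} ⊗ ⋯ ⊗ e_{n_k+1}` in `Γ(K_p)`, namely the product of the weights of
the factors. -/
def wordWeight (p : ℤ) (α : List ℕ) : ℝ≥0 := (α.map fun n => letterWeight n ^ p).prod

theorem wordWeight_pos (p : ℤ) (α : List ℕ) : 0 < wordWeight p α := by
  induction α with
  | nil => simp [wordWeight]
  | cons n α ih =>
    have : wordWeight p (n :: α) = letterWeight n ^ p * wordWeight p α := by simp [wordWeight]
    rw [this]
    have : 0 < letterWeight n := by unfold letterWeight; positivity
    positivity

theorem wordWeight_mono {p q : ℤ} (h : p ≤ q) (α : List ℕ) :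
    wordWeight p α ≤ wordWeight q α := by
  induction α with
  | nil => simp [wordWeight]
  | cons n α ih =>
    have e (r : ℤ) : wordWeight r (n :: α) = letterWeight n ^ r * wordWeight r α := by
      simp [wordWeight]
    rw [e, e]
    have h1 : 1 ≤ letterWeight n := one_le_pow₀ one_le_two
    exact mul_le_mul' (zpow_le_zpow_right₀ h1 h) ih

/-- The full Fock space `Γ(K_p) = ⊕ₖ K_p^{⊗k}` in coordinates: all families `u` indexed by words
with `∑ α, wordWeight p α * |u α|² < ∞`. -/
def fockSubmodule (p : ℤ) : Submodule ℂ (List ℕ → ℂ) := weightedL2 (wordWeight p)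

theorem fockSubmodule_anti {p q : ℤ} (h : p ≤ q) : fockSubmodule q ≤ fockSubmodule p := by
  intro u hu
  refine Summable.of_nonneg_of_le (fun α => by positivity) (fun α => ?_) (mem_weightedL2.1 hu)
  have := wordWeight_mono h α
  gcongr

/-- The Fock space `Γ(K_p)` as a normed space (with norm given in `Fock.norm_sq`). -/
def Fock (p : ℤ) : Type := fockSubmodule p

namespace Fock

instance (p : ℤ) : AddCommGroup (Fock p) := inferInstanceAs (AddCommGroup (fockSubmodule p))

instance (p : ℤ) : Module ℂ (Fock p) := inferInstanceAs (Module ℂ (fockSubmodule p))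

/-- The isometry of `Γ(K_p)` into the unweighted `ℓ²` space over words. -/
def toLp (p : ℤ) : Fock p →ₗ[ℂ] lp (fun _ : List ℕ => ℂ) 2 := toLp2 (wordWeight p)

theorem toLp_injective (p : ℤ) : Function.Injective (toLp p) := by
  intro u v h
  refine Subtype.ext (funext fun α => ?_)
  have h1 := congrFun (congrArg Subtype.val h) α
  have h2 : ((Real.sqrt (wordWeight p α) : ℝ) : ℂ) ≠ 0 := by
    have : 0 < (wordWeight p α : ℝ) := wordWeight_pos p α
    exact_mod_cast (Real.sqrt_pos.2 this).ne'
  exact mul_left_cancel₀ h2 h1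

instance (p : ℤ) : NormedAddCommGroup (Fock p) :=
  NormedAddCommGroup.induced _ _ (toLp p) (toLp_injective p)

instance (p : ℤ) : NormedSpace ℂ (Fock p) := NormedSpace.induced _ _ _ (toLp p)

theorem norm_sq (p : ℤ) (u : Fock p) :
    ‖u‖ ^ 2 = ∑' α, (wordWeight p α : ℝ) * ‖u.1 α‖ ^ 2 := by
  have h : ‖u‖ = ‖toLp p u‖ := rfl
  have h2 := lp.norm_rpow_eq_tsum (p := 2) (by norm_num) (toLp p u)
  rw [h]
  simp only [ENNReal.toReal_ofNat, Real.rpow_ofNat] at h2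
  rw [h2]
  refine tsum_congr fun α => ?_
  have h3 : (toLp p u) α = ((Real.sqrt (wordWeight p α) : ℝ) : ℂ) * u.1 α := rfl
  rw [h3, norm_mul, mul_pow]
  simp [Real.sq_sqrt]

end Fock

/-- The test space `G̃₁ = ⋂_{p ∈ ℕ} Γ(K_p)`. -/
def G1 : Type := (⨅ p : ℕ, fockSubmodule p : Submodule ℂ (List ℕ → ℂ))

namespace G1

instance : AddCommGroup G1 :=
  inferInstanceAs (AddCommGroup (⨅ p : ℕ, fockSubmodule p : Submodule ℂ (List ℕ → ℂ)))

instance : Module ℂ G1 :=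
  inferInstanceAs (Module ℂ (⨅ p : ℕ, fockSubmodule p : Submodule ℂ (List ℕ → ℂ)))

/-- The coordinates of an element of `G̃₁`. -/
def coeff (f : G1) : List ℕ → ℂ := f.1

/-- The inclusion `G̃₁ ⊆ Γ(K_p)`. -/
def toFock (p : ℕ) : G1 →ₗ[ℂ] Fock p :=
  Submodule.inclusion (iInf_le (fun p : ℕ => fockSubmodule p) p)

/-- The projective limit (Fréchet) topology: the coarsest one that makes all the inclusions
`G̃₁ ⊆ Γ(K_p)` continuous. -/
instance : TopologicalSpace G1 :=
  ⨅ p : ℕ, TopologicalSpace.induced (toFock p) inferInstance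

end G1

/-- The distribution space `G̃₋₁ = ⋃_{p ∈ ℕ} Γ(K_{-p})`, as a submodule. -/
def gm1Submodule : Submodule ℂ (List ℕ → ℂ) where
  carrier := {u | ∃ p : ℕ, u ∈ fockSubmodule (-(p : ℤ))}
  zero_mem' := ⟨0, Submodule.zero_mem _⟩
  add_mem' := by
    rintro a b ⟨p, hp⟩ ⟨q, hq⟩
    refine ⟨max p q, Submodule.add_mem _ (fockSubmodule_anti ?_ hp) (fockSubmodule_anti ?_ hq)⟩
    · have := le_max_left p q
      omega
    · have := le_max_right p q
      omega
  smul_mem' := by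
    rintro c a ⟨p, hp⟩
    exact ⟨p, Submodule.smul_mem _ c hp⟩

/-- The distribution space `G̃₋₁ = ⋃_{p ∈ ℕ} Γ(K_{-p})`. -/
def Gm1 : Type := gm1Submodule

namespace Gm1

instance : AddCommGroup Gm1 := inferInstanceAs (AddCommGroup gm1Submodule)

instance : Module ℂ Gm1 := inferInstanceAs (Module ℂ gm1Submodule)

/-- The coordinates of an element of `G̃₋₁`. -/
def coeff (F : Gm1) : List ℕ → ℂ := F.1

/-- The inclusion `Γ(K_{-p}) ⊆ G̃₋₁`. -/
def ofFock (p : ℕ) : Fock (-(p : ℤ)) →ₗ[ℂ] Gm1 :=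
  Submodule.inclusion (show fockSubmodule (-(p : ℤ)) ≤ gm1Submodule from fun _ hu => ⟨p, hu⟩)

/-- The vector space topologies on `G̃₋₁` that are locally convex and make all the inclusions
`Γ(K_{-p}) ⊆ G̃₋₁` continuous. -/
def admissibleTopologies : Set (TopologicalSpace Gm1) :=
  {t | @IsTopologicalAddGroup Gm1 t _ ∧ @ContinuousSMul ℂ Gm1 _ _ t ∧
    @LocallyConvexSpace ℝ Gm1 _ _ _ _ t ∧ ∀ p : ℕ, @Continuous _ _ _ t (ofFock p)}

/-- The locally convex inductive limit topology of `G̃₋₁ = ⋃_p Γ(K_{-p})`: the finest locally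
convex topology that makes all the inclusions continuous.  The embeddings
`Γ(K_{-p}) ⊆ Γ(K_{-q})` being Hilbert-Schmidt for large `q - p`, it is also the strong topology
of `G̃₋₁` as the dual of `G̃₁`. -/
instance : TopologicalSpace Gm1 := sInf admissibleTopologies

instance : IsTopologicalAddGroup Gm1 := topologicalAddGroup_sInf fun _ ht => ht.1

instance : ContinuousSMul ℂ Gm1 := continuousSMul_sInf fun _ ht => ht.2.1

instance : LocallyConvexSpace ℝ Gm1 := .sInf fun _ ht => ht.2.2.1

theorem continuous_ofFock (p : ℕ) : Continuous (ofFock p) :=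
  continuous_sInf_rng.2 fun _ ht => ht.2.2.2 p

end Gm1

/-! ### Creation and annihilation operators -/

/-- The creation operator `ℓ_h u = h ⊗ u`, in coordinates. -/
def creation (h : ℕ → ℂ) (u : List ℕ → ℂ) : List ℕ → ℂ
  | [] => 0
  | n :: α => h n * u α

/-- The annihilation operator `ℓ_h^*`, given by `ℓ_h^* (k ⊗ u) = ⟨h, k⟩ u` and `ℓ_h^* Ω = 0`, in
coordinates.  It is the adjoint of `creation h`, see `annihilation_adjoint`. -/
def annihilation (h : ℕ → ℂ) (u : List ℕ → ℂ) : List ℕ → ℂ :=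
  fun α => ∑' n, conj (h n) * u (n :: α)

/-- The operator `X_h = ℓ_h + ℓ_h^*`. -/
def freeField (h : ℕ → ℂ) (u : List ℕ → ℂ) : List ℕ → ℂ :=
  creation h u + annihilation h u

/-- For `h ∈ K_{-q}`, `v ∈ Γ(K_{-q})` and `u ∈ Γ(K_q)` one has `⟨ℓ_h v, u⟩ = ⟨v, ℓ_h^* u⟩`, in the
pairing of `Γ(K_{-q})` and `Γ(K_q)` that extends the inner product of `Γ(K_0)`. -/
theorem annihilation_adjoint {q : ℤ} {h : ℕ → ℂ} {u v : List ℕ → ℂ} (hh : h ∈ K (-q))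
    (hv : v ∈ fockSubmodule (-q)) (hu : u ∈ fockSubmodule q) :
    ∑' α, conj (creation h v α) * u α = ∑' α, conj (v α) * annihilation h u α := by
  have hinj : Function.Injective fun x : List ℕ × ℕ => x.2 :: x.1 := by
    rintro ⟨α, n⟩ ⟨β, k⟩ hx
    simp only [List.cons.injEq] at hx
    exact Prod.ext hx.2 hx.1
  have e1 : ∑' α, conj (creation h v α) * u α =
      ∑' x : List ℕ × ℕ, conj (v x.1) * (conj (h x.2) * u (x.2 :: x.1)) := by
    rw [← hinj.tsum_eq]
    · refine tsum_congr fun x => ?_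
      simp only [creation, map_mul]
      ring
    · intro α hα
      cases α with
      | nil => simp [creation] at hα
      | cons n α => exact ⟨(α, n), rfl⟩
  have hs : Summable fun x : List ℕ × ℕ => conj (v x.1) * (conj (h x.2) * u (x.2 :: x.1)) := by
    have s1 := (mem_weightedL2.1 hv).mul_of_nonneg (mem_weightedL2.1 hh)
      (fun α => by positivity) (fun n => by positivity)
    have s2 := (mem_weightedL2.1 hu).comp_injective hinj
    refine Summable.of_norm_bounded (s1.add s2) fun x => ?_
    obtain ⟨α, n⟩ := x
    have hA : 0 < (wordWeight (-q) α : ℝ) := wordWeight_pos _ _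
    have hN0 : 0 < letterWeight n := by unfold letterWeight; positivity
    have hN : 0 < ((letterWeight n ^ (-q) : ℝ≥0) : ℝ) := by
      have : 0 < letterWeight n ^ (-q) := zpow_pos hN0 _
      exact_mod_cast this
    have hinv (β : List ℕ) : (wordWeight q β : ℝ) = ((wordWeight (-q) β : ℝ))⁻¹ := by
      induction β with
      | nil => simp [wordWeight]
      | cons k β ih =>
        have e (r : ℤ) : wordWeight r (k :: β) = letterWeight k ^ r * wordWeight r β := by
          simp [wordWeight]
        rw [e, e, NNReal.coe_mul, ih]
        push_cast
        rw [mul_inv, zpow_neg, inv_inv]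
    have ec : (wordWeight (-q) (n :: α) : ℝ) =
        ((letterWeight n ^ (-q) : ℝ≥0) : ℝ) * (wordWeight (-q) α : ℝ) := by
      simp [wordWeight]
    simp only [Function.comp_apply, hinv, ec, norm_mul, RCLike.norm_conj]
    generalize ((letterWeight n ^ (-q) : ℝ≥0) : ℝ) = N at hN
    generalize (wordWeight (-q) α : ℝ) = A at hA
    have hNA : 0 < N * A := mul_pos hN hA
    have key : A * ‖v α‖ ^ 2 * (N * ‖h n‖ ^ 2) + (N * A)⁻¹ * ‖u (n :: α)‖ ^ 2 -
        ‖v α‖ * (‖h n‖ * ‖u (n :: α)‖) = (N * A)⁻¹ *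
          (((N * A) * (‖v α‖ * ‖h n‖) - ‖u (n :: α)‖ / 2) ^ 2 + 3 / 4 * ‖u (n :: α)‖ ^ 2) := by
      field_simp
      ring
    have : 0 ≤ (N * A)⁻¹ *
          (((N * A) * (‖v α‖ * ‖h n‖) - ‖u (n :: α)‖ / 2) ^ 2 + 3 / 4 * ‖u (n :: α)‖ ^ 2) := by
      positivity
    linarith
  rw [e1, hs.tsum_prod]
  refine tsum_congr fun α => ?_
  simp only [annihilation]
  exact tsum_mul_left

/-! ### Hermite functions, the Fourier transform and `T_m 1_{[0,t]}` -/

/-- The Hermite function `e_{n+1}(x) = h_n(√2 x) e^{-x²/2} / (π^{1/4} √(n!))`, where `h_n` is the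
`n`-th (probabilists') Hermite polynomial.  These functions are the orthonormal basis of
`K_0 = L²(ℝ, dx)` that is used throughout. -/
def hermiteFun (n : ℕ) (x : ℝ) : ℂ :=
  ((Polynomial.aeval (Real.sqrt 2 * x) (Polynomial.hermite n) * Real.exp (-x ^ 2 / 2) /
    (Real.pi ^ (1 / 4 : ℝ) * Real.sqrt (n.factorial)) : ℝ) : ℂ)

/-- The Fourier transform `f̂(u) = ∫ e^{-iux} f(x) dx` of an integrable function. -/
def ft (f : ℝ → ℂ) (u : ℝ) : ℂ := ∫ x : ℝ, Complex.exp (-(Complex.I * u * x)) * f x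

/-- The function `1_{[0,t]}`, understood as `-1_{[t,0]}` for `t < 0`. -/
def indicatorTo (t : ℝ) : ℝ → ℂ :=
  if 0 ≤ t then (Set.Icc 0 t).indicator 1 else -(Set.Icc t 0).indicator 1

/-- The relation `T_m f = g` in `L²(ℝ, dx)`: `f` is in the domain of `T_m` and
`ĝ(u) = √(m(u)) f̂(u)` for almost every `u`.  Mathlib's (unitary) transform `𝓕` satisfies
`f̂(2πξ) = (𝓕 f)(ξ)`. -/
def IsTm (m : ℝ → ℝ) (f g : Lp ℂ 2 (volume : Measure ℝ)) : Prop :=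
  ∀ᵐ ξ : ℝ, (𝓕 g : Lp ℂ 2 (volume : Measure ℝ)) ξ =
    (Real.sqrt (m (2 * Real.pi * ξ)) : ℂ) * (𝓕 f : Lp ℂ 2 (volume : Measure ℝ)) ξ

/-- The function `√(m(u)) (1_{[0,t]})^(u) conj(ê_{n+1}(u))`. -/
def tmDensity (m : ℝ → ℝ) (t : ℝ) (n : ℕ) (u : ℝ) : ℂ :=
  (Real.sqrt (m u) : ℂ) * ft (indicatorTo t) u * conj (ft (hermiteFun n) u)

/-- The Hermite coefficients `⟨e_{n+1}, T_m 1_{[0,t]}⟩` of the generalized function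
`T_m 1_{[0,t]}`, whose Fourier transform is `√m (1_{[0,t]})^`, computed by Plancherel's formula. -/
def tmIndicator (m : ℝ → ℝ) (t : ℝ) (n : ℕ) : ℂ :=
  (1 / (2 * Real.pi) : ℂ) * ∫ u : ℝ, tmDensity m t n u

end FreeNoise

end

noncomputable section

namespace FreeNoise

/-! ### Hermite polynomials and Hermite functions -/

/-! Everything reduces to bounds on Hermite coefficients that are geometric in the index. The weight
`a_{n+1}^(-p) = 2^(-(n+1)p)` outweighs any factor `A^(2n)` once `2A² ≤ 2^p`, so a sequence of size
`C·A^n` lies in `K (-p)` with norm at most a constant times `C` (`geometric_mem_K`).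

The Hermite functions are eigenfunctions of the Fourier transform. A crude bound from the three-term
recurrence gives `|ê_{n+1}(u)| ≤ √(2π) A^n e^{-u²/4}` with `A = hermiteRate`; the dependence on `n`
is far from sharp, but Gaussian decay survives and absorbs the exponential growth of `√m`. Near `0`,
`√m` is at most `√K |u|^(-b/2)`, integrable because `b < 2`. Hence the `α_n(t)` are `O(A^n)`
(`integrable_envelope`, `norm_tmCoeff_le`).

The difference quotient of the transform of `1_{[0,t]}` differs from `e^{-iut}` by at most `|u||s|`;
this extra `|u|` is harmless against the Gaussian. So the coefficients are differentiable in `t`,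
with error `O(|s| A^n)`. Since `ℓ_h + ℓ_h^*` maps `Γ(K_p)` to `Γ(K_{-p})` with norm at most twice
that of `h` in `K (-p)`, the derivative already exists in one space `Γ(K_{-p})`, with `W_m(t)` the
field of the formal vector `T_m δ_t`; continuity of the inclusion carries it to `G̃₋₁`.

The `L²` statement is Plancherel, once the `L²` transform is identified with the Fourier integral on
`L¹ ∩ L²`. -/

theorem derivative_hermite_succ (n : ℕ) :
    Polynomial.derivative (Polynomial.hermite (n + 1)) =
      ((n + 1 : ℕ) : Polynomial ℤ) * Polynomial.hermite n := by
  induction n with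
  | zero => simp
  | succ n ih =>
    rw [Polynomial.hermite_succ (n + 1), ih]
    simp only [Polynomial.derivative_sub, Polynomial.derivative_mul, Polynomial.derivative_X, ih,
      Polynomial.derivative_natCast]
    rw [Polynomial.hermite_succ n]
    push_cast
    ring

theorem aeval_hermite_succ_succ (n : ℕ) (y : ℝ) :
    Polynomial.aeval y (Polynomial.hermite (n + 2)) =
      y * Polynomial.aeval y (Polynomial.hermite (n + 1)) -
        (n + 1) * Polynomial.aeval y (Polynomial.hermite n) := by
  rw [Polynomial.hermite_succ (n + 1), derivative_hermite_succ]
  simp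

/-- Induction on the three-term recurrence: with `r = |y|` and `s = √(n+1)`, the step is `r(r + s) +
s² ≤ (r + s)²`. -/
theorem abs_aeval_hermite_le (n : ℕ) (y : ℝ) :
    |Polynomial.aeval y (Polynomial.hermite n)| ≤ (|y| + √n) ^ n := by
  induction n using Nat.strong_induction_on with
  | _ n ih =>
    match n with
    | 0 => simp
    | 1 => simp
    | n + 2 =>
      have h1 := ih (n + 1) (by omega)
      have h0 := ih n (by omega)
      have hr := abs_nonneg y
      have s0 : √(n : ℝ) ≤ √((n + 1 : ℕ) : ℝ) := Real.sqrt_le_sqrt (by push_cast; linarith)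
      have s1 : √((n + 1 : ℕ) : ℝ) ≤ √((n + 2 : ℕ) : ℝ) :=
        Real.sqrt_le_sqrt (by push_cast; linarith)
      have hsq : √((n + 1 : ℕ) : ℝ) ^ 2 = n + 1 := by
        rw [Real.sq_sqrt (by positivity)]; push_cast; ring
      set s := √((n + 1 : ℕ) : ℝ)
      have hs : 0 ≤ s := Real.sqrt_nonneg _
      have h0' : |Polynomial.aeval y (Polynomial.hermite n)| ≤ (|y| + s) ^ n :=
        h0.trans (by gcongr)
      rw [aeval_hermite_succ_succ]
      calc |y * Polynomial.aeval y (Polynomial.hermite (n + 1)) -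
              (n + 1) * Polynomial.aeval y (Polynomial.hermite n)|
          ≤ |y| * |Polynomial.aeval y (Polynomial.hermite (n + 1))| +
              (n + 1) * |Polynomial.aeval y (Polynomial.hermite n)| := by
            refine (abs_sub _ _).trans (le_of_eq ?_)
            rw [abs_mul, abs_mul, abs_of_nonneg (by positivity : (0 : ℝ) ≤ n + 1)]
        _ ≤ |y| * (|y| + s) ^ (n + 1) + s ^ 2 * (|y| + s) ^ n := by
            rw [hsq]; gcongr
        _ = (|y| + s) ^ n * (|y| * (|y| + s) + s ^ 2) := by ring
        _ ≤ (|y| + s) ^ n * (|y| + s) ^ 2 := by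
            gcongr
            nlinarith [mul_nonneg hr hs]
        _ = (|y| + s) ^ (n + 2) := by ring
        _ ≤ _ := by gcongr

theorem sq_aeval_hermite_le (n : ℕ) (y : ℝ) :
    Polynomial.aeval y (Polynomial.hermite n) ^ 2 ≤
      n.factorial * (8 * Real.exp (1 / 4)) ^ n * Real.exp (y ^ 2 / 4) := by
  have h1 := abs_aeval_hermite_le n y
  have hsn : √(n : ℝ) ^ 2 = n := Real.sq_sqrt (by positivity)
  have h2 : (|y| + √n) ^ 2 ≤ 8 * ((y ^ 2 + n) / 4) := by
    nlinarith [sq_nonneg (|y| - √n), sq_abs y]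
  have h3 := Real.pow_div_factorial_le_exp (x := (y ^ 2 + n) / 4) (by positivity) n
  rw [div_le_iff₀ (by positivity)] at h3
  calc Polynomial.aeval y (Polynomial.hermite n) ^ 2
      = |Polynomial.aeval y (Polynomial.hermite n)| ^ 2 := (sq_abs _).symm
    _ ≤ ((|y| + √n) ^ n) ^ 2 := by gcongr
    _ = ((|y| + √n) ^ 2) ^ n := by rw [← pow_mul, ← pow_mul, mul_comm]
    _ ≤ (8 * ((y ^ 2 + n) / 4)) ^ n := by gcongr
    _ = 8 ^ n * ((y ^ 2 + n) / 4) ^ n := by rw [mul_pow]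
    _ ≤ 8 ^ n * (Real.exp ((y ^ 2 + n) / 4) * n.factorial) := by gcongr
    _ = _ := by
      rw [mul_pow, ← Real.exp_nat_mul, add_div, Real.exp_add]
      ring_nf

/-- The unnormalized Hermite function `h_n(√2 x) e^{-x²/2}`. -/
def hermiteRaw (n : ℕ) (x : ℝ) : ℝ :=
  Polynomial.aeval (√2 * x) (Polynomial.hermite n) * Real.exp (-x ^ 2 / 2)

/-- The normalizing constant `π^{1/4} √(n!)` of the Hermite functions. -/
def hermiteNorm (n : ℕ) : ℝ := Real.pi ^ (1 / 4 : ℝ) * √(n.factorial)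

theorem one_le_hermiteNorm (n : ℕ) : 1 ≤ hermiteNorm n := by
  unfold hermiteNorm
  have h1 : 1 ≤ Real.pi ^ (1 / 4 : ℝ) :=
    Real.one_le_rpow (by linarith [Real.pi_gt_three]) (by norm_num)
  have h2 : 1 ≤ √(n.factorial : ℝ) := by
    rw [Real.one_le_sqrt]
    exact_mod_cast Nat.one_le_iff_ne_zero.2 n.factorial_ne_zero
  nlinarith

theorem hermiteFun_eq (n : ℕ) (x : ℝ) :
    hermiteFun n x = ((hermiteNorm n)⁻¹ : ℝ) * (hermiteRaw n x : ℂ) := by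
  rw [hermiteFun, hermiteNorm, hermiteRaw, ← Complex.ofReal_mul]
  congr 1
  ring

/-- The growth rate in `n` of the bounds for the Hermite functions. -/
def hermiteRate : ℝ := √(8 * Real.exp (1 / 4))

theorem abs_hermiteRaw_le (n : ℕ) (x : ℝ) :
    |hermiteRaw n x| ≤ √(n.factorial) * hermiteRate ^ n * Real.exp (-x ^ 2 / 4) := by
  refine abs_le.2 (abs_le_of_sq_le_sq' ?_ (by unfold hermiteRate; positivity))
  have h := sq_aeval_hermite_le n (√2 * x)
  have e2 : hermiteRate ^ 2 = 8 * Real.exp (1 / 4) := Real.sq_sqrt (by positivity)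
  have e1 : √(n.factorial : ℝ) ^ 2 = n.factorial := Real.sq_sqrt (by positivity)
  have e3 : (√2 : ℝ) ^ 2 = 2 := Real.sq_sqrt (by norm_num)
  calc hermiteRaw n x ^ 2
      = Polynomial.aeval (√2 * x) (Polynomial.hermite n) ^ 2 * Real.exp (-x ^ 2) := by
        rw [hermiteRaw, mul_pow, ← Real.exp_nat_mul]
        congr 2; push_cast; ring
    _ ≤ n.factorial * (8 * Real.exp (1 / 4)) ^ n * Real.exp ((√2 * x) ^ 2 / 4) *
          Real.exp (-x ^ 2) := by gcongr
    _ = n.factorial * (8 * Real.exp (1 / 4)) ^ n * Real.exp (-x ^ 2 / 4) ^ 2 := by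
        rw [mul_assoc, ← Real.exp_add, ← Real.exp_nat_mul, mul_pow (√2), e3]
        congr 2; push_cast; ring
    _ = _ := by
        rw [mul_pow (_ * _) (Real.exp _), mul_pow (√_), e1, ← pow_mul, mul_comm n 2, pow_mul, e2]

theorem norm_hermiteFun_le (n : ℕ) (x : ℝ) :
    ‖hermiteFun n x‖ ≤ hermiteRate ^ n * Real.exp (-x ^ 2 / 4) := by
  have h1 := abs_hermiteRaw_le n x
  have h2 : 1 ≤ Real.pi ^ (1 / 4 : ℝ) :=
    Real.one_le_rpow (by linarith [Real.pi_gt_three]) (by norm_num)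
  have hN : 0 < hermiteNorm n := by linarith [one_le_hermiteNorm n]
  have h3 : √(n.factorial : ℝ) ≤ hermiteNorm n := by
    unfold hermiteNorm
    exact le_mul_of_one_le_left (by positivity) h2
  rw [hermiteFun_eq, norm_mul, Complex.norm_real, Complex.norm_real, Real.norm_eq_abs,
    Real.norm_eq_abs, abs_of_pos (inv_pos.2 hN), inv_mul_le_iff₀ hN]
  refine h1.trans ?_
  rw [mul_assoc]
  refine mul_le_mul_of_nonneg_right h3 ?_
  unfold hermiteRate
  positivity

/-- The ladder relation: `√2 · hermiteRaw (n + 1)` is `x - d/dx` applied to `hermiteRaw n`. The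
Fourier transform exchanges these two operations, which drives the induction for the eigenfunction
property. -/
theorem hermiteRaw_succ (n : ℕ) (x : ℝ) :
    HasDerivAt (hermiteRaw n) (x * hermiteRaw n x - √2 * hermiteRaw (n + 1) x) x := by
  unfold hermiteRaw
  have h1 : HasDerivAt (fun x : ℝ => √2 * x) √2 x := by
    simpa using (hasDerivAt_id x).const_mul √2
  have h2 := (Polynomial.hasDerivAt_aeval (Polynomial.hermite n) (√2 * x)).comp x h1
  have h3 : HasDerivAt (fun x : ℝ => -x ^ 2 / 2) (-x) x := by
    have := ((hasDerivAt_id x).pow 2).neg.div_const 2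
    refine this.congr_deriv ?_
    simp only [id, Nat.cast_ofNat]
    ring
  refine (h2.mul h3.exp).congr_deriv ?_
  have e3 : (√2 : ℝ) * √2 = 2 := Real.mul_self_sqrt (by norm_num)
  simp only [Polynomial.hermite_succ, map_sub, map_mul, Polynomial.aeval_X, Function.comp_apply]
  linear_combination (x * (Polynomial.aeval (√2 * x)) (Polynomial.hermite n) *
    Real.exp (-x ^ 2 / 2)) * e3

theorem continuous_hermiteRaw (n : ℕ) : Continuous (hermiteRaw n) :=
  continuous_iff_continuousAt.2 fun x => (hermiteRaw_succ n x).continuousAt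

theorem continuous_hermiteFun (n : ℕ) : Continuous (hermiteFun n) := by
  rw [funext (hermiteFun_eq n)]
  have := continuous_hermiteRaw n
  fun_prop

theorem integrable_of_gaussian_bound {f : ℝ → ℂ} (hf : AEStronglyMeasurable f volume) (C : ℝ)
    (hb : ∀ x, ‖f x‖ ≤ C * Real.exp (-x ^ 2 / 4)) : Integrable f := by
  refine ((integrable_exp_neg_mul_sq (b := 1 / 4) (by norm_num)).const_mul C).mono' hf
    (ae_of_all _ fun x => (hb x).trans (le_of_eq ?_))
  ring_nf

theorem integrable_hermiteRaw (n : ℕ) : Integrable fun x => (hermiteRaw n x : ℂ) := by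
  have := continuous_hermiteRaw n
  refine integrable_of_gaussian_bound (by fun_prop) (√(n.factorial) * hermiteRate ^ n) fun x => ?_
  simpa using abs_hermiteRaw_le n x

theorem integrable_mul_hermiteRaw (n : ℕ) : Integrable fun x : ℝ => (x : ℂ) * hermiteRaw n x := by
  have := continuous_hermiteRaw n
  refine ((integrable_mul_exp_neg_mul_sq (b := 1 / 4) (by norm_num)).norm.const_mul
    (√(n.factorial) * hermiteRate ^ n)).mono' (by fun_prop) (ae_of_all _ fun x => ?_)
  have h := mul_le_mul_of_nonneg_left (abs_hermiteRaw_le n x) (abs_nonneg x)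
  simp only [norm_mul, Complex.norm_real, Real.norm_eq_abs, Real.abs_exp]
  refine h.trans (le_of_eq ?_)
  ring_nf

/-! ### Hermite functions as eigenfunctions of the Fourier transform -/

theorem ft_eq_fourier (f : ℝ → ℂ) (u : ℝ) : ft f u = 𝓕 f (u / (2 * Real.pi)) := by
  rw [ft, Real.fourier_real_eq_integral_exp_smul]
  refine integral_congr_ae (ae_of_all _ fun x => ?_)
  have : (Real.pi : ℂ) ≠ 0 := by exact_mod_cast Real.pi_ne_zero
  simp only [smul_eq_mul]
  congr 2
  push_cast
  field_simp

theorem fourier_eq_ft (f : ℝ → ℂ) (ξ : ℝ) : 𝓕 f ξ = ft f (2 * Real.pi * ξ) := by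
  rw [ft_eq_fourier]
  field_simp

/-- The Gaussian is its own transform up to scaling, and the raising operator `x - d/dx` commutes
with the transform up to the factor `-i`. -/
theorem fourier_hermiteRaw (n : ℕ) (ξ : ℝ) :
    𝓕 (fun x => (hermiteRaw n x : ℂ)) ξ =
      √(2 * Real.pi) * (-Complex.I) ^ n * hermiteRaw n (2 * Real.pi * ξ) := by
  induction n generalizing ξ with
  | zero =>
    have h := congrFun (fourier_gaussian_pi (b := ((1 / (2 * Real.pi) : ℝ) : ℂ))
      (by rw [Complex.ofReal_re]; positivity)) ξ
    have hpi : (Real.pi : ℂ) ≠ 0 := by exact_mod_cast Real.pi_ne_zero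
    have e : (fun x => (hermiteRaw 0 x : ℂ)) =
        fun x : ℝ => Complex.exp (-Real.pi * ((1 / (2 * Real.pi) : ℝ) : ℂ) * x ^ 2) := by
      funext x
      simp only [hermiteRaw, Polynomial.hermite_zero, map_one, one_mul, Complex.ofReal_exp]
      congr 1
      push_cast
      field_simp
    rw [e, h]
    congr 1
    · rw [show (1 / 2 : ℂ) = ((1 / 2 : ℝ) : ℂ) by push_cast; rfl,
        ← Complex.ofReal_cpow (by positivity), ← Real.sqrt_eq_rpow, Real.sqrt_div zero_le_one]
      simp
    · simp only [hermiteRaw, Polynomial.hermite_zero, map_one, one_mul, Complex.ofReal_exp]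
      congr 1
      push_cast
      field_simp
  | succ n ih =>
    have e2 : (√2 : ℂ) ≠ 0 := by
      exact_mod_cast (Real.sqrt_pos.2 (by norm_num : (0 : ℝ) < 2)).ne'
    have hpi : (Real.pi : ℂ) ≠ 0 := by exact_mod_cast Real.pi_ne_zero
    have hd (x : ℝ) : HasDerivAt (fun x => (hermiteRaw n x : ℂ))
        ((x : ℂ) * hermiteRaw n x - √2 * hermiteRaw (n + 1) x) x := by
      simpa using (hermiteRaw_succ n x).ofReal_comp
    have hde : deriv (fun x => (hermiteRaw n x : ℂ)) =
        fun x : ℝ => (x : ℂ) * hermiteRaw n x - √2 * hermiteRaw (n + 1) x :=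
      funext fun x => (hd x).deriv
    have hi1 := integrable_mul_hermiteRaw n
    have hi2 := (integrable_hermiteRaw (n + 1)).const_mul (√2 : ℂ)
    have f1 := Real.fourier_deriv (integrable_hermiteRaw n)
      (fun x => (hd x).differentiableAt) (by rw [hde]; exact hi1.sub hi2)
    have f2 := Real.hasDerivAt_fourier (integrable_hermiteRaw n) hi1 ξ
    have f3 : HasDerivAt (𝓕 fun x => (hermiteRaw n x : ℂ))
        (√(2 * Real.pi) * (-Complex.I) ^ n * (2 * Real.pi *
          ((2 * Real.pi * ξ) * hermiteRaw n (2 * Real.pi * ξ) -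
            √2 * hermiteRaw (n + 1) (2 * Real.pi * ξ)))) ξ := by
      rw [funext ih]
      have g1 : HasDerivAt (fun ξ : ℝ => 2 * Real.pi * ξ) (2 * Real.pi) ξ := by
        simpa using (hasDerivAt_id ξ).const_mul (2 * Real.pi)
      have g2 := ((hermiteRaw_succ n (2 * Real.pi * ξ)).comp ξ g1).ofReal_comp
      refine (g2.const_mul _).congr_deriv ?_
      push_cast
      ring
    -- The derivative of the transform, computed under the integral and from the induction
    -- hypothesis, gives the transform of `x · hermiteRaw n`; `f5` then yields that of `hermiteRaw
    -- (n + 1)`.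
    have f4 := f2.unique f3
    have f5 := congrFun f1 ξ
    rw [hde, ih] at f5
    have l1 : 𝓕 (fun x : ℝ => (x : ℂ) * hermiteRaw n x - √2 * hermiteRaw (n + 1) x) ξ =
        𝓕 (fun x : ℝ => (x : ℂ) * hermiteRaw n x) ξ -
          √2 * 𝓕 (fun x : ℝ => (hermiteRaw (n + 1) x : ℂ)) ξ := by
      simp only [fourier_eq_ft, ft]
      rw [← integral_const_mul, ← integral_sub]
      · refine integral_congr_ae (ae_of_all _ fun x => ?_)
        simp only
        ring
      · exact hi1.bdd_mul (c := 1) (by fun_prop) (ae_of_all _ fun x => by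
          simp [Complex.norm_exp])
      · exact ((integrable_hermiteRaw (n + 1)).bdd_mul (c := 1) (by fun_prop)
          (ae_of_all _ fun x => by simp [Complex.norm_exp])).const_mul _
    have l2 : 𝓕 (fun x : ℝ => (-2 * Real.pi * Complex.I * x) • (hermiteRaw n x : ℂ)) ξ =
        (-2 * Real.pi * Complex.I) * 𝓕 (fun x : ℝ => (x : ℂ) * hermiteRaw n x) ξ := by
      simp only [fourier_eq_ft, ft]
      rw [← integral_const_mul]
      refine integral_congr_ae (ae_of_all _ fun x => ?_)
      simp only [smul_eq_mul]
      ring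
    rw [l2] at f4
    rw [l1] at f5
    have f6 : 𝓕 (fun x : ℝ => (x : ℂ) * hermiteRaw n x) ξ =
        √(2 * Real.pi) * (-Complex.I) ^ n * Complex.I *
          ((2 * Real.pi * ξ) * hermiteRaw n (2 * Real.pi * ξ) -
            √2 * hermiteRaw (n + 1) (2 * Real.pi * ξ)) := by
      have h2 : (-2 * Real.pi * Complex.I : ℂ) ≠ 0 := by simp [hpi]
      refine mul_left_cancel₀ h2 (f4.trans ?_)
      linear_combination (2 * Real.pi * √(2 * Real.pi) * (-Complex.I) ^ n *
          ((2 * Real.pi * ξ) * hermiteRaw n (2 * Real.pi * ξ) -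
            √2 * hermiteRaw (n + 1) (2 * Real.pi * ξ)) : ℂ) * Complex.I_sq
    refine mul_left_cancel₀ e2 ?_
    rw [f6] at f5
    simp only [smul_eq_mul] at f5
    linear_combination -f5

theorem ft_hermiteFun (n : ℕ) (u : ℝ) :
    ft (hermiteFun n) u = √(2 * Real.pi) * (-Complex.I) ^ n * hermiteFun n u := by
  have h := fourier_hermiteRaw n (u / (2 * Real.pi))
  rw [← ft_eq_fourier, mul_div_cancel₀ _ (by positivity)] at h
  have e : ft (hermiteFun n) u =
      ((hermiteNorm n)⁻¹ : ℝ) * ft (fun x => (hermiteRaw n x : ℂ)) u := by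
    simp only [ft]
    rw [← integral_const_mul]
    refine integral_congr_ae (ae_of_all _ fun x => ?_)
    simp only [hermiteFun_eq]
    ring
  rw [e, h, hermiteFun_eq]
  ring

theorem continuous_ft_hermiteFun (n : ℕ) : Continuous (ft (hermiteFun n)) := by
  rw [funext (ft_hermiteFun n)]
  have := continuous_hermiteFun n
  fun_prop

theorem norm_ft_hermiteFun_le (n : ℕ) (u : ℝ) :
    ‖ft (hermiteFun n) u‖ ≤ √(2 * Real.pi) * hermiteRate ^ n * Real.exp (-u ^ 2 / 4) := by
  rw [ft_hermiteFun]
  simp only [norm_mul, Complex.norm_real, norm_pow, norm_neg, Complex.norm_I, one_pow, mul_one,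
    Real.norm_eq_abs, abs_of_nonneg (Real.sqrt_nonneg _)]
  rw [mul_assoc]
  gcongr
  exact norm_hermiteFun_le n u

theorem integrable_hermiteFun (n : ℕ) : Integrable (hermiteFun n) :=
  integrable_of_gaussian_bound (continuous_hermiteFun n).aestronglyMeasurable _
    (norm_hermiteFun_le n)

theorem memLp_two_hermiteFun (n : ℕ) : MemLp (hermiteFun n) 2 := by
  have hc := continuous_hermiteFun n
  rw [memLp_two_iff_integrable_sq_norm hc.aestronglyMeasurable]
  refine ((integrable_hermiteFun n).norm.const_mul (hermiteRate ^ n)).mono' (by fun_prop)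
    (ae_of_all _ fun x => ?_)
  have h := norm_hermiteFun_le n x
  have h1 : Real.exp (-x ^ 2 / 4) ≤ 1 := Real.exp_le_one_iff.2 (by nlinarith [sq_nonneg x])
  have h2 : 0 ≤ hermiteRate ^ n := by unfold hermiteRate; positivity
  have h3 : ‖hermiteFun n x‖ ≤ hermiteRate ^ n := by nlinarith
  rw [Real.norm_eq_abs, abs_of_nonneg (by positivity), sq]
  gcongr

/-! ### The operators `ℓ_h + ℓ_h^*` from `Γ(K_p)` to `Γ(K_{-p})` -/

theorem letterWeight_pos (n : ℕ) : 0 < letterWeight n := by unfold letterWeight; positivity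

theorem wordWeight_cons (p : ℤ) (n : ℕ) (α : List ℕ) :
    (wordWeight p (n :: α) : ℝ) = (letterWeight n : ℝ) ^ p * wordWeight p α := by
  simp [wordWeight]

theorem injective_cons_prod : Function.Injective fun x : ℕ × List ℕ => x.1 :: x.2 := by
  rintro ⟨n, α⟩ ⟨k, β⟩ hx
  simp only [List.cons.injEq] at hx
  exact Prod.ext hx.1 hx.2

/-- The squared norm `∑ |h_n|² a_n ^ p` of `K_p`. -/
def normSqK (p : ℤ) (h : ℕ → ℂ) : ℝ := ∑' n, (letterWeight n : ℝ) ^ p * ‖h n‖ ^ 2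

/-- The squared norm of `Γ(K_p)`. -/
def normSqFock (p : ℤ) (u : List ℕ → ℂ) : ℝ := ∑' α, (wordWeight p α : ℝ) * ‖u α‖ ^ 2

theorem normSqK_nonneg (p : ℤ) (h : ℕ → ℂ) : 0 ≤ normSqK p h :=
  tsum_nonneg fun n => mul_nonneg (zpow_nonneg (letterWeight n).coe_nonneg _) (sq_nonneg _)

theorem mem_K {p : ℤ} {h : ℕ → ℂ} :
    h ∈ K p ↔ Summable fun n => (letterWeight n : ℝ) ^ p * ‖h n‖ ^ 2 := by
  rw [K, mem_weightedL2]
  simp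

theorem mem_fockSubmodule {p : ℤ} {u : List ℕ → ℂ} :
    u ∈ fockSubmodule p ↔ Summable fun α => (wordWeight p α : ℝ) * ‖u α‖ ^ 2 := Iff.rfl

/-- Weights are multiplicative along words, so the sum over nonempty words factors as a product of
two sums; the empty word contributes nothing. -/
theorem creation_bound {p : ℤ} {h : ℕ → ℂ} {u : List ℕ → ℂ} (hh : h ∈ K p)
    (hu : u ∈ fockSubmodule p) :
    creation h u ∈ fockSubmodule p ∧
      normSqFock p (creation h u) = normSqK p h * normSqFock p u := by
  have e (x : ℕ × List ℕ) : (wordWeight p (x.1 :: x.2) : ℝ) * ‖creation h u (x.1 :: x.2)‖ ^ 2 =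
      ((letterWeight x.1 : ℝ) ^ p * ‖h x.1‖ ^ 2) * ((wordWeight p x.2 : ℝ) * ‖u x.2‖ ^ 2) := by
    rw [wordWeight_cons, creation, norm_mul]
    ring
  have h0 : ∀ α ∉ Set.range fun x : ℕ × List ℕ => x.1 :: x.2,
      (wordWeight p α : ℝ) * ‖creation h u α‖ ^ 2 = 0 := by
    intro α hα
    cases α with
    | nil => simp [creation]
    | cons n α => exact absurd ⟨(n, α), rfl⟩ hα
  have hs := (mem_K.1 hh).mul_of_nonneg (mem_fockSubmodule.1 hu)
    (fun n => mul_nonneg (zpow_nonneg (letterWeight n).coe_nonneg _) (sq_nonneg _))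
    (fun α => by positivity)
  refine ⟨?_, ?_⟩
  · rw [mem_fockSubmodule, ← injective_cons_prod.summable_iff h0]
    exact hs.congr fun x => (e x).symm
  · rw [normSqFock, ← injective_cons_prod.tsum_eq
      (Function.support_subset_iff'.2 h0), tsum_congr e, normSqK, normSqFock]
    exact ((mem_K.1 hh).tsum_mul_tsum (mem_fockSubmodule.1 hu) hs).symm

/-- The Cauchy-Schwarz inequality for the pairing of `K_{-p}` and `K_p`. -/
theorem pairing_bound {p : ℤ} {h v : ℕ → ℂ} (hh : h ∈ K (-p)) (hv : v ∈ K p) :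
    (Summable fun n => conj (h n) * v n) ∧
      ‖∑' n, conj (h n) * v n‖ ^ 2 ≤ normSqK (-p) h * normSqK p v := by
  have hw (n : ℕ) : 0 < (letterWeight n : ℝ) := letterWeight_pos n
  have e1 (n : ℕ) : (√((letterWeight n : ℝ) ^ (-p)) * ‖h n‖) ^ (2 : ℝ) =
      (letterWeight n : ℝ) ^ (-p) * ‖h n‖ ^ 2 := by
    rw [Real.rpow_ofNat, mul_pow, Real.sq_sqrt (zpow_nonneg (hw n).le _)]
  have e2 (n : ℕ) : (√((letterWeight n : ℝ) ^ p) * ‖v n‖) ^ (2 : ℝ) =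
      (letterWeight n : ℝ) ^ p * ‖v n‖ ^ 2 := by
    rw [Real.rpow_ofNat, mul_pow, Real.sq_sqrt (zpow_nonneg (hw n).le _)]
  have e3 (n : ℕ) : (√((letterWeight n : ℝ) ^ (-p)) * ‖h n‖) *
      (√((letterWeight n : ℝ) ^ p) * ‖v n‖) = ‖conj (h n) * v n‖ := by
    rw [mul_mul_mul_comm, ← Real.sqrt_mul (zpow_nonneg (hw n).le _), ← zpow_add₀ (hw n).ne']
    simp
  have := Real.summable_and_inner_le_Lp_mul_Lq_tsum_of_nonneg (Real.HolderConjugate.two_two)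
    (f := fun n => √((letterWeight n : ℝ) ^ (-p)) * ‖h n‖)
    (g := fun n => √((letterWeight n : ℝ) ^ p) * ‖v n‖)
    (fun n => by positivity) (fun n => by positivity)
    ((mem_K.1 hh).congr fun n => (e1 n).symm) ((mem_K.1 hv).congr fun n => (e2 n).symm)
  simp only [e1, e2, e3] at this
  obtain ⟨hs, hle⟩ := this
  refine ⟨hs.of_norm, ?_⟩
  have hb := (norm_tsum_le_tsum_norm hs).trans hle
  rw [← Real.sqrt_eq_rpow, ← Real.sqrt_eq_rpow] at hb
  calc _ ≤ (√(normSqK (-p) h) * √(normSqK p v)) ^ 2 := by gcongr; exact hb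
    _ = _ := by rw [mul_pow, Real.sq_sqrt (normSqK_nonneg _ _), Real.sq_sqrt (normSqK_nonneg _ _)]

theorem summable_prod_of_mem {p : ℤ} {u : List ℕ → ℂ} (hu : u ∈ fockSubmodule p) :
    Summable fun x : List ℕ × ℕ => (wordWeight p (x.2 :: x.1) : ℝ) * ‖u (x.2 :: x.1)‖ ^ 2 :=
  (mem_fockSubmodule.1 hu).comp_injective (injective_cons_prod.comp Prod.swap_injective)

theorem slice_mem {p : ℤ} {u : List ℕ → ℂ} (hu : u ∈ fockSubmodule p) (α : List ℕ) :
    (fun n => u (n :: α)) ∈ K p := by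
  have hA : 0 < (wordWeight p α : ℝ) := wordWeight_pos _ _
  have := ((summable_prod_of_mem hu).prod_factor α).mul_left (wordWeight p α : ℝ)⁻¹
  refine mem_K.2 (this.congr fun n => ?_)
  rw [wordWeight_cons]
  field_simp

/-- Cauchy-Schwarz in the removed first letter, for each remaining word `α`; then the sum over `α`
is the part of the squared norm of `u` carried by nonempty words. -/
theorem annihilation_bound {p : ℤ} (hp : 0 ≤ p) {h : ℕ → ℂ} {u : List ℕ → ℂ} (hh : h ∈ K (-p))
    (hu : u ∈ fockSubmodule p) :
    annihilation h u ∈ fockSubmodule (-p) ∧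
      normSqFock (-p) (annihilation h u) ≤ normSqK (-p) h * normSqFock p u := by
  have hs := summable_prod_of_mem hu
  have hle (α : List ℕ) : (wordWeight (-p) α : ℝ) * ‖annihilation h u α‖ ^ 2 ≤
      normSqK (-p) h * ∑' n, (wordWeight p (n :: α) : ℝ) * ‖u (n :: α)‖ ^ 2 := by
    have e : ∑' n, (wordWeight p (n :: α) : ℝ) * ‖u (n :: α)‖ ^ 2 =
        wordWeight p α * normSqK p fun n => u (n :: α) := by
      rw [normSqK, ← tsum_mul_left]
      refine tsum_congr fun n => ?_
      rw [wordWeight_cons]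
      ring
    rw [e]
    -- Here `0 ≤ p` enters: passing to the larger weight recombines it with that of the first
    -- letter.
    have hA : (wordWeight (-p) α : ℝ) ≤ wordWeight p α := wordWeight_mono (by omega) α
    calc _ ≤ (wordWeight p α : ℝ) * (normSqK (-p) h * normSqK p fun n => u (n :: α)) := by
          gcongr
          exact (pairing_bound hh (slice_mem hu α)).2
      _ = _ := by ring
  have hs2 := hs.prod.mul_left (normSqK (-p) h)
  have hmem : annihilation h u ∈ fockSubmodule (-p) :=
    mem_fockSubmodule.2 (Summable.of_nonneg_of_le (fun α => by positivity) hle hs2)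
  refine ⟨hmem, ((mem_fockSubmodule.1 hmem).tsum_le_tsum hle hs2).trans ?_⟩
  rw [tsum_mul_left]
  refine mul_le_mul_of_nonneg_left ?_ (normSqK_nonneg _ _)
  rw [← hs.tsum_prod]
  exact tsum_comp_le_tsum_of_inj (mem_fockSubmodule.1 hu) (fun α => by positivity)
    (injective_cons_prod.comp Prod.swap_injective)

theorem annihilation_add {p : ℤ} {h : ℕ → ℂ} {u v : List ℕ → ℂ} (hh : h ∈ K (-p))
    (hu : u ∈ fockSubmodule p) (hv : v ∈ fockSubmodule p) :
    annihilation h (u + v) = annihilation h u + annihilation h v := by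
  funext α
  simp only [annihilation, Pi.add_apply, mul_add]
  exact (pairing_bound hh (slice_mem hu α)).1.tsum_add (pairing_bound hh (slice_mem hv α)).1

theorem annihilation_smul (h : ℕ → ℂ) (c : ℂ) (u : List ℕ → ℂ) :
    annihilation h (c • u) = c • annihilation h u := by
  funext α
  simp only [annihilation, Pi.smul_apply, smul_eq_mul, ← tsum_mul_left]
  exact tsum_congr fun n => by ring

theorem creation_add (h : ℕ → ℂ) (u v : List ℕ → ℂ) :
    creation h (u + v) = creation h u + creation h v := by
  funext α
  cases α <;> simp [creation, mul_add]

theorem creation_smul (h : ℕ → ℂ) (c : ℂ) (u : List ℕ → ℂ) :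
    creation h (c • u) = c • creation h u := by
  funext α
  cases α <;> simp [creation, mul_left_comm]

/-- The creation operator `ℓ_h : Γ(K_p) → Γ(K_{-p})` for `h ∈ K_{-p}`. -/
def creationFock (p : ℕ) (h : ℕ → ℂ) (hh : h ∈ K (-(p : ℤ))) : Fock p →ₗ[ℂ] Fock (-(p : ℤ)) where
  toFun u := ⟨creation h u.1, (creation_bound hh (fockSubmodule_anti (by omega) u.2)).1⟩
  map_add' u v := Subtype.ext (creation_add h u.1 v.1)
  map_smul' c u := Subtype.ext (creation_smul h c u.1)

/-- The annihilation operator `ℓ_h^* : Γ(K_p) → Γ(K_{-p})` for `h ∈ K_{-p}`. -/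
def annihilationFock (p : ℕ) (h : ℕ → ℂ) (hh : h ∈ K (-(p : ℤ))) :
    Fock p →ₗ[ℂ] Fock (-(p : ℤ)) where
  toFun u := ⟨annihilation h u.1, (annihilation_bound (by omega) hh u.2).1⟩
  map_add' u v := Subtype.ext (annihilation_add hh u.2 v.2)
  map_smul' c u := Subtype.ext (annihilation_smul h c u.1)

theorem Fock.norm_le_of_normSq_le {p q : ℤ} {u : Fock p} {v : Fock q} {S : ℝ} (hS : 0 ≤ S)
    (h : normSqFock p u.1 ≤ S * normSqFock q v.1) : ‖u‖ ≤ √S * ‖v‖ := by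
  refine le_of_sq_le_sq ?_ (by positivity)
  rw [mul_pow, Real.sq_sqrt hS, Fock.norm_sq, Fock.norm_sq]
  exact h

theorem norm_creationFock_le (p : ℕ) (h : ℕ → ℂ) (hh : h ∈ K (-(p : ℤ))) (u : Fock p) :
    ‖creationFock p h hh u‖ ≤ √(normSqK (-(p : ℤ)) h) * ‖u‖ := by
  have hu : u.1 ∈ fockSubmodule (-(p : ℤ)) := fockSubmodule_anti (by omega) u.2
  refine Fock.norm_le_of_normSq_le (normSqK_nonneg _ _) ?_
  refine (creation_bound hh hu).2.le.trans ?_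
  refine mul_le_mul_of_nonneg_left ?_ (normSqK_nonneg _ _)
  refine (mem_fockSubmodule.1 hu).tsum_le_tsum (fun α => ?_) (mem_fockSubmodule.1 u.2)
  have hA : (wordWeight (-(p : ℤ)) α : ℝ) ≤ wordWeight p α := wordWeight_mono (by omega) α
  gcongr

theorem norm_annihilationFock_le (p : ℕ) (h : ℕ → ℂ) (hh : h ∈ K (-(p : ℤ))) (u : Fock p) :
    ‖annihilationFock p h hh u‖ ≤ √(normSqK (-(p : ℤ)) h) * ‖u‖ :=
  Fock.norm_le_of_normSq_le (normSqK_nonneg _ _) (annihilation_bound (by omega) hh u.2).2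

/-- The operator `ℓ_h + ℓ_h^* : Γ(K_p) → Γ(K_{-p})` for `h ∈ K_{-p}`. -/
def fieldFock (p : ℕ) (h : ℕ → ℂ) (hh : h ∈ K (-(p : ℤ))) : Fock p →L[ℂ] Fock (-(p : ℤ)) :=
  (creationFock p h hh + annihilationFock p h hh).mkContinuous (2 * √(normSqK (-(p : ℤ)) h))
    fun u => (norm_add_le _ _).trans (by
      have h1 := norm_creationFock_le p h hh u
      have h2 := norm_annihilationFock_le p h hh u
      linarith)

theorem norm_fieldFock_le (p : ℕ) (h : ℕ → ℂ) (hh : h ∈ K (-(p : ℤ))) (u : Fock p) :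
    ‖fieldFock p h hh u‖ ≤ 2 * √(normSqK (-(p : ℤ)) h) * ‖u‖ := by
  refine ((fieldFock p h hh).le_opNorm u).trans ?_
  gcongr
  exact LinearMap.mkContinuous_norm_le _ (by positivity) _

theorem G1.continuous_toFock (p : ℕ) : Continuous (G1.toFock p) :=
  continuous_iInf_dom continuous_induced_dom

/-- The operator `ℓ_h + ℓ_h^*` in `L(G̃₁, G̃₋₁)` for `h ∈ K_{-p}`. -/
def field (p : ℕ) (h : ℕ → ℂ) (hh : h ∈ K (-(p : ℤ))) : G1 →L[ℂ] Gm1 where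
  toLinearMap := Gm1.ofFock p ∘ₗ (fieldFock p h hh).toLinearMap ∘ₗ G1.toFock p
  cont := (Gm1.continuous_ofFock p).comp
    ((fieldFock p h hh).continuous.comp (G1.continuous_toFock p))

/-- The scalar must be real, since annihilation is conjugate-linear in `h`. The memberships make the
annihilation series summable, so that they can be combined termwise. -/
theorem freeField_real_combination {p : ℤ} {h₁ h₂ h₃ : ℕ → ℂ} {u : List ℕ → ℂ} (a : ℝ)
    (h1 : h₁ ∈ K (-p)) (h2 : h₂ ∈ K (-p)) (h3 : h₃ ∈ K (-p)) (hu : u ∈ fockSubmodule p) :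
    freeField ((a : ℂ) • (h₁ - h₂) - h₃) u =
      (a : ℂ) • (freeField h₁ u - freeField h₂ u) - freeField h₃ u := by
  have hc : creation ((a : ℂ) • (h₁ - h₂) - h₃) u =
      (a : ℂ) • (creation h₁ u - creation h₂ u) - creation h₃ u := by
    funext α
    cases α with
    | nil => simp [creation]
    | cons n α =>
      simp only [creation, Pi.sub_apply, Pi.smul_apply, smul_eq_mul]
      ring
  have ha : annihilation ((a : ℂ) • (h₁ - h₂) - h₃) u =
      (a : ℂ) • (annihilation h₁ u - annihilation h₂ u) - annihilation h₃ u := by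
    funext α
    have s1 := (pairing_bound h1 (slice_mem hu α)).1
    have s2 := (pairing_bound h2 (slice_mem hu α)).1
    have s3 := (pairing_bound h3 (slice_mem hu α)).1
    simp only [annihilation, Pi.sub_apply, Pi.smul_apply, smul_eq_mul]
    rw [← s1.tsum_sub s2, ← tsum_mul_left, ← ((s1.sub s2).mul_left _).tsum_sub s3]
    refine tsum_congr fun n => ?_
    simp only [map_sub, map_mul, Complex.conj_ofReal]
    ring
  rw [freeField, freeField, freeField, freeField, hc, ha]
  module

/-- The hypothesis on `p` leaves a geometric series of ratio `1/2`, whose sum is the factor `2`. -/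
theorem geometric_mem_K {A C : ℝ} {p : ℕ} (hp : 2 * A ^ 2 ≤ 2 ^ p) {h : ℕ → ℂ}
    (hh : ∀ n, ‖h n‖ ≤ C * A ^ n) :
    h ∈ K (-(p : ℤ)) ∧ normSqK (-(p : ℤ)) h ≤ 2 * C ^ 2 := by
  have hle (n : ℕ) : (letterWeight n : ℝ) ^ (-(p : ℤ)) * ‖h n‖ ^ 2 ≤ C ^ 2 * (1 / 2) ^ n := by
    have h1 : ‖h n‖ ^ 2 ≤ C ^ 2 * (A ^ 2) ^ n := by
      calc ‖h n‖ ^ 2 ≤ (C * A ^ n) ^ 2 := by gcongr; exact hh n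
        _ = _ := by ring
    have h2 : (2 * A ^ 2) ^ n ≤ (letterWeight n : ℝ) ^ p := by
      calc (2 * A ^ 2) ^ n ≤ ((2 : ℝ) ^ p) ^ n := by gcongr
        _ = 2 ^ (p * n) := by rw [pow_mul]
        _ ≤ 2 ^ (p * (n + 1)) := pow_le_pow_right₀ one_le_two (by gcongr; omega)
        _ = _ := by rw [letterWeight]; push_cast; rw [← pow_mul, mul_comm]
    have hw : 0 < (letterWeight n : ℝ) ^ p := pow_pos (letterWeight_pos n) p
    rw [zpow_neg, zpow_natCast, inv_mul_le_iff₀ hw]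
    calc ‖h n‖ ^ 2 ≤ C ^ 2 * (A ^ 2) ^ n := h1
      _ = (2 * A ^ 2) ^ n * (C ^ 2 * (1 / 2) ^ n) := by
        rw [mul_pow, one_div, inv_pow]
        field_simp
      _ ≤ _ := by gcongr
  have hg := summable_geometric_two.mul_left (C ^ 2)
  have hs : Summable fun n => (letterWeight n : ℝ) ^ (-(p : ℤ)) * ‖h n‖ ^ 2 :=
    Summable.of_nonneg_of_le
      (fun n => mul_nonneg (zpow_nonneg (letterWeight n).coe_nonneg _) (sq_nonneg _)) hle hg
  refine ⟨mem_K.2 hs, (hs.tsum_le_tsum hle hg).trans (le_of_eq ?_)⟩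
  rw [tsum_mul_left, tsum_geometric_two, mul_comm]

/-- If the coefficients of `h(t)` are differentiable in `t`, with exponential bounds in the index
that are uniform in the difference quotients, then `t ↦ ℓ_{h(t)} + ℓ_{h(t)}^*` is differentiable
as a map into `L(G̃₁, G̃₋₁)`, pointwise on `G̃₁`. -/
theorem exists_field_derivative {h h' : ℝ → ℕ → ℂ} {A : ℝ} {C : ℝ → ℝ} {C' : ℝ}
    (hh : ∀ t n, ‖h t n‖ ≤ C t * A ^ n) (hh' : ∀ t n, ‖h' t n‖ ≤ C' * A ^ n)
    (hd : ∀ t s n, s ≠ 0 →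
      ‖((s⁻¹ : ℝ) : ℂ) * (h (t + s) n - h t n) - h' t n‖ ≤ (|s| * C') * A ^ n) :
    ∃ X W : ℝ → (G1 →L[ℂ] Gm1),
      (∀ t f, (X t f).coeff = freeField (h t) f.coeff) ∧
      ∀ t f, Tendsto (fun s : ℝ => (s : ℂ)⁻¹ • (X (t + s) f - X t f)) (𝓝[≠] 0) (𝓝 (W t f)) := by
  -- `p` depends only on the rate `A`, so the same pair `Γ(K_p)`, `Γ(K_{-p})` serves all `t` and
  -- `s`.
  obtain ⟨p, hp⟩ := pow_unbounded_of_one_lt (2 * A ^ 2) (one_lt_two : (1 : ℝ) < 2)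
  have m1 (t : ℝ) : h t ∈ K (-(p : ℤ)) := (geometric_mem_K hp.le (hh t)).1
  have m2 (t : ℝ) : h' t ∈ K (-(p : ℤ)) := (geometric_mem_K hp.le (hh' t)).1
  have m3 (t s : ℝ) : ((s⁻¹ : ℝ) : ℂ) • (h (t + s) - h t) - h' t ∈ K (-(p : ℤ)) :=
    Submodule.sub_mem _ (Submodule.smul_mem _ _ (Submodule.sub_mem _ (m1 _) (m1 _))) (m2 _)
  refine ⟨fun t => field p (h t) (m1 t), fun t => field p (h' t) (m2 t), fun t f => rfl,
    fun t f => ?_⟩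
  -- The difference quotient minus the candidate derivative is the field of a single vector, whose
  -- `K (-p)` norm is `O(|s|)`.
  have hz : Tendsto (fun s => fieldFock p _ (m3 t s) (G1.toFock p f)) (𝓝[≠] 0) (𝓝 0) := by
    have hlim : Tendsto (fun s : ℝ => 2 * √(2 * (|s| * C') ^ 2) * ‖G1.toFock p f‖)
        (𝓝[≠] 0) (𝓝 0) := by
      have : Continuous fun s : ℝ => 2 * √(2 * (|s| * C') ^ 2) * ‖G1.toFock p f‖ := by fun_prop
      simpa using (this.tendsto 0).mono_left nhdsWithin_le_nhds
    refine squeeze_zero_norm' ?_ hlim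
    filter_upwards [self_mem_nhdsWithin] with s hs
    refine (norm_fieldFock_le p _ (m3 t s) _).trans ?_
    gcongr
    exact (geometric_mem_K hp.le fun n => hd t s n hs).2
  have hz2 := ((Gm1.continuous_ofFock p).tendsto 0).comp hz
  rw [map_zero] at hz2
  have hz3 := hz2.add_const (field p (h' t) (m2 t) f)
  rw [zero_add] at hz3
  refine hz3.congr fun s => ?_
  have e : Gm1.ofFock p (fieldFock p _ (m3 t s) (G1.toFock p f)) =
      ((s⁻¹ : ℝ) : ℂ) • (field p (h (t + s)) (m1 _) f - field p (h t) (m1 t) f) -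
        field p (h' t) (m2 t) f :=
    Subtype.ext
      (freeField_real_combination s⁻¹ (m1 (t + s)) (m1 t) (m2 t) (G1.toFock p f).2)
  simp only [Function.comp_apply]
  rw [e, sub_add_cancel, Complex.ofReal_inv]

/-! ### The Fourier transform on `L¹ ∩ L²` and the Fourier transform of `1_{[0,t]}` -/

theorem continuous_fourier_of_integrable {f : ℝ → ℂ} (hf : Integrable f) : Continuous (𝓕 f) :=
  VectorFourier.fourierIntegral_continuous Real.continuous_fourierChar
    (by exact continuous_inner) hf

theorem continuous_ft {f : ℝ → ℂ} (hf : Integrable f) : Continuous (ft f) := by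
  rw [funext (ft_eq_fourier f)]
  exact (continuous_fourier_of_integrable hf).comp (continuous_id.div_const _)

/-- On `L¹ ∩ L²`, the Fourier transform of `L²` is given by the Fourier integral. -/
theorem fourier_toLp_ae_eq {f : ℝ → ℂ} (h1 : Integrable f) (h2 : MemLp f 2) :
    ((𝓕 (h2.toLp f) : Lp ℂ 2 (volume : Measure ℝ)) : ℝ → ℂ) =ᵐ[volume] 𝓕 f := by
  refine ae_eq_of_integral_contDiff_smul_eq
    ((Lp.memLp _).locallyIntegrable (by norm_num))
    (continuous_fourier_of_integrable h1).locallyIntegrable fun g hg hgc => ?_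
  have hgc' : HasCompactSupport (fun x => (g x : ℂ)) := hgc.comp_left Complex.ofReal_zero
  let φ : SchwartzMap ℝ ℂ := hgc'.toSchwartzMap (Complex.ofRealCLM.contDiff.comp hg)
  have hφ (x : ℝ) : φ x = (g x : ℂ) := rfl
  -- Tested against `φ`, the `L²` transform moves onto `φ` through tempered distributions; `e3`
  -- moves it back onto `f` by the `L¹` multiplication formula.
  have e1 := DFunLike.congr_fun (Lp.fourier_toTemperedDistribution_eq (h2.toLp f)) φ
  rw [TemperedDistribution.fourier_apply, Lp.toTemperedDistribution_apply,
    Lp.toTemperedDistribution_apply] at e1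
  have e2 : ∫ x, (𝓕 φ) x • (h2.toLp f) x = ∫ x, (𝓕 (φ : ℝ → ℂ)) x • f x :=
    integral_congr_ae (by
      filter_upwards [h2.coeFn_toLp] with x hx
      rw [hx, SchwartzMap.fourier_coe])
  have e3 : ∫ x, (𝓕 (φ : ℝ → ℂ)) x • f x = ∫ x, φ x • (𝓕 f) x := by
    simpa using! VectorFourier.integral_fourierIntegral_smul_eq_flip (L := innerₗ ℝ)
      Real.continuous_fourierChar continuous_inner φ.integrable h1
  rw [e2, e3] at e1
  simpa only [hφ, Complex.real_smul, smul_eq_mul] using e1.symm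

/-! ### The Fourier transform of the indicator and its difference quotients -/

theorem indicatorTo_memLp (t : ℝ) (p : ℝ≥0∞) : MemLp (indicatorTo t) p := by
  unfold indicatorTo
  split_ifs
  · exact memLp_indicator_const p measurableSet_Icc 1 (Or.inr (by simp))
  · exact (memLp_indicator_const p measurableSet_Icc 1 (Or.inr (by simp))).neg

theorem integrable_indicatorTo (t : ℝ) : Integrable (indicatorTo t) :=
  memLp_one_iff_integrable.1 (indicatorTo_memLp t 1)

theorem ft_indicatorTo (t u : ℝ) :
    ft (indicatorTo t) u = ∫ x in (0 : ℝ)..t, Complex.exp (-(Complex.I * u * x)) := by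
  have key (a b : ℝ) (c : ℂ) :
      ∫ x : ℝ, Complex.exp (-(Complex.I * u * x)) * (c * (Set.Icc a b).indicator 1 x) =
        c * ∫ x in Set.Ioc a b, Complex.exp (-(Complex.I * u * x)) := by
    rw [← integral_Icc_eq_integral_Ioc, ← integral_indicator measurableSet_Icc,
      ← integral_const_mul]
    refine integral_congr_ae (ae_of_all _ fun x => ?_)
    by_cases hx : x ∈ Set.Icc a b <;> simp [hx, mul_comm]
  unfold ft indicatorTo
  split_ifs with ht
  · rw [intervalIntegral.integral_of_le ht]
    simpa using key 0 t 1
  · rw [intervalIntegral.integral_of_ge (not_le.1 ht).le]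
    simpa using key t 0 (-1)

theorem norm_exp_neg_I_mul (u x : ℝ) : ‖Complex.exp (-(Complex.I * u * x))‖ = 1 := by
  simp [Complex.norm_exp]

theorem norm_ft_indicatorTo_le (t u : ℝ) : ‖ft (indicatorTo t) u‖ ≤ |t| := by
  rw [ft_indicatorTo]
  refine (intervalIntegral.norm_integral_le_of_norm_le_const (C := 1)
    fun x _ => (norm_exp_neg_I_mul u x).le).trans (by simp)

theorem abs_mul_norm_ft_indicatorTo_le (t u : ℝ) : |u| * ‖ft (indicatorTo t) u‖ ≤ 2 := by
  rcases eq_or_ne u 0 with rfl | hu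
  · simp
  have hc : -(Complex.I * u) ≠ 0 := by simp [hu]
  have h : ft (indicatorTo t) u =
      (Complex.exp (-(Complex.I * u) * t) - Complex.exp (-(Complex.I * u) * (0 : ℝ))) /
        -(Complex.I * u) := by
    rw [ft_indicatorTo, ← integral_exp_mul_complex hc]
    simp only [neg_mul]
  have e : ‖-(Complex.I * u)‖ = |u| := by simp
  rw [h, norm_div, e, mul_div_cancel₀ _ (abs_ne_zero.2 hu)]
  refine (norm_sub_le _ _).trans ?_
  rw [neg_mul, neg_mul, norm_exp_neg_I_mul, norm_exp_neg_I_mul]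
  norm_num

/-- This decay is what makes `√m` times the transform square integrable when `m(u)/(1 + u²)` is
integrable. -/
theorem normSq_ft_indicatorTo_le (t u : ℝ) :
    (1 + u ^ 2) * ‖ft (indicatorTo t) u‖ ^ 2 ≤ t ^ 2 + 4 := by
  have h1 := pow_le_pow_left₀ (norm_nonneg _) (norm_ft_indicatorTo_le t u) 2
  have h2 := pow_le_pow_left₀ (by positivity) (abs_mul_norm_ft_indicatorTo_le t u) 2
  rw [mul_pow, sq_abs] at h2
  rw [sq_abs] at h1
  linarith

theorem norm_exp_sub_exp_le (u x t : ℝ) :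
    ‖Complex.exp (-(Complex.I * u * x)) - Complex.exp (-(Complex.I * u * t))‖ ≤
      |u| * |x - t| := by
  have e : Complex.exp (-(Complex.I * u * x)) - Complex.exp (-(Complex.I * u * t)) =
      Complex.exp (-(Complex.I * u * t)) *
        (Complex.exp (Complex.I * ((-(u * (x - t)) : ℝ) : ℂ)) - 1) := by
    rw [mul_sub, ← Complex.exp_add, mul_one]
    congr 2
    push_cast
    ring
  rw [e, norm_mul, norm_exp_neg_I_mul, one_mul]
  refine (Real.norm_exp_I_mul_ofReal_sub_one_le).trans (le_of_eq ?_)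
  rw [Real.norm_eq_abs, abs_neg, abs_mul]

/-- The error is the integral of `e^{-iux} - e^{-iut}` over an interval of length `|s|`, where the
integrand is at most `|u||s|`. -/
theorem norm_ft_indicatorTo_sub_le (t s u : ℝ) :
    ‖ft (indicatorTo (t + s)) u - ft (indicatorTo t) u -
      s * Complex.exp (-(Complex.I * u * t))‖ ≤ |u| * |s| * |s| := by
  have hc : Continuous fun x : ℝ => Complex.exp (-(Complex.I * u * x)) := by fun_prop
  have e : ft (indicatorTo (t + s)) u - ft (indicatorTo t) u -
      s * Complex.exp (-(Complex.I * u * t)) =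
      ∫ x in t..t + s, (Complex.exp (-(Complex.I * u * x)) -
        Complex.exp (-(Complex.I * u * t))) := by
    rw [ft_indicatorTo, ft_indicatorTo, intervalIntegral.integral_interval_sub_left
      (hc.intervalIntegrable _ _) (hc.intervalIntegrable _ _),
      intervalIntegral.integral_sub (hc.intervalIntegrable _ _) (by simp),
      intervalIntegral.integral_const, add_sub_cancel_left, Complex.real_smul]
  rw [e]
  refine (intervalIntegral.norm_integral_le_of_norm_le_const (C := |u| * |s|)
    fun x hx => (norm_exp_sub_exp_le u x t).trans ?_).trans (by rw [add_sub_cancel_left])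
  have := Set.abs_sub_left_of_mem_uIcc (Set.uIoc_subset_uIcc hx)
  rw [add_sub_cancel_left] at this
  exact mul_le_mul_of_nonneg_left this (abs_nonneg u)

/-! ### The coefficients of `T_m 1_{[0,t]}` -/

/-- The function `√(m(u)) (1 + |u|) e^{-u²/4}`, which dominates all the integrands. -/
def envelope (m : ℝ → ℝ) (u : ℝ) : ℝ := √(m u) * (1 + |u|) * Real.exp (-u ^ 2 / 4)

theorem envelope_nonneg (m : ℝ → ℝ) (u : ℝ) : 0 ≤ envelope m u := by
  unfold envelope; positivity

theorem integrable_envelope {m : ℝ → ℝ} (hm : Measurable m) {b K C₁ C₂ : ℝ} (hb : b < 2)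
    (hm0 : ∀ u, 0 ≤ m u) (hC₁ : 0 < C₁)
    (hsmall : ∀ t : ℝ, t ≠ 0 → |t| ≤ 1 → m t ≤ K * |t| ^ (-b))
    (hlarge : ∀ t : ℝ, 1 ≤ |t| → m t ≤ C₁ * Real.exp (C₂ * |t|)) :
    Integrable (envelope m) := by
  have hK : 0 ≤ K := by simpa using (hm0 1).trans (hsmall 1 one_ne_zero (by simp))
  -- `C₂ / 2` comes from the square root of the bound on `m`, and `1` from `1 + |u| ≤ e^{|u|}`.
  set a := C₂ / 2 + 1 with ha
  have i1 : IntegrableOn (fun u : ℝ => |u| ^ (-(b / 2))) (Set.Icc (-1) 1) := by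
    refine LocallyIntegrable.integrableOn_isCompact ?_ isCompact_Icc
    refine locallyIntegrable_of_norm_le_rpow (C := 1) (α := b / 2) (by simp)
      (by simp; linarith) (ae_of_all _ fun u => ?_)
      (Measurable.aestronglyMeasurable (by fun_prop))
    rw [one_mul, Real.norm_eq_abs, Real.norm_eq_abs, abs_of_nonneg (by positivity)]
  have i2 : Integrable ((Set.Icc (-1 : ℝ) 1).indicator fun u => 2 * √K * |u| ^ (-(b / 2))) :=
    (integrable_indicator_iff measurableSet_Icc).2 (i1.const_mul _)
  have i3 := (integrable_exp_neg_mul_sq (b := 1 / 8) (by norm_num)).const_mul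
    (√C₁ * Real.exp (2 * a ^ 2))
  refine (i2.add i3).mono' ?_ ?_
  · unfold envelope
    exact Measurable.aestronglyMeasurable (by fun_prop)
  -- The origin is discarded because the hypotheses do not bound `m 0`.
  filter_upwards [compl_mem_ae_iff.2 (measure_singleton (0 : ℝ))] with u hu
  have hu0 : u ≠ 0 := hu
  rw [Real.norm_eq_abs, abs_of_nonneg (envelope_nonneg m u), Pi.add_apply]
  have hexp : Real.exp (-u ^ 2 / 4) ≤ 1 := Real.exp_le_one_iff.2 (by nlinarith [sq_nonneg u])
  by_cases hu1 : |u| ≤ 1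
  · have hmem : u ∈ Set.Icc (-1 : ℝ) 1 := abs_le.1 hu1
    rw [Set.indicator_of_mem hmem]
    have h1 : √(m u) ≤ √K * |u| ^ (-(b / 2)) := by
      refine (Real.sqrt_le_sqrt (hsmall u hu0 hu1)).trans (le_of_eq ?_)
      rw [Real.sqrt_mul hK, Real.sqrt_eq_rpow (|u| ^ (-b)), ← Real.rpow_mul (abs_nonneg u)]
      congr 2
      ring
    have h2 : envelope m u ≤ 2 * √K * |u| ^ (-(b / 2)) := by
      calc envelope m u ≤ (√K * |u| ^ (-(b / 2))) * (1 + 1) * 1 := by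
            unfold envelope; gcongr
        _ = _ := by ring
    have : 0 ≤ √C₁ * Real.exp (2 * a ^ 2) * Real.exp (-(1 / 8) * u ^ 2) := by positivity
    linarith
  · have hmem : u ∉ Set.Icc (-1 : ℝ) 1 := fun h => hu1 (abs_le.2 h)
    rw [Set.indicator_of_notMem hmem, zero_add]
    have h1 : √(m u) ≤ √C₁ * Real.exp (C₂ * |u| / 2) := by
      refine (Real.sqrt_le_sqrt (hlarge u (not_le.1 hu1).le)).trans (le_of_eq ?_)
      rw [Real.sqrt_mul hC₁.le, Real.exp_half]
    have h2 : 1 + |u| ≤ Real.exp |u| := by linarith [Real.add_one_le_exp |u|]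
    calc envelope m u
        ≤ (√C₁ * Real.exp (C₂ * |u| / 2)) * Real.exp |u| * Real.exp (-u ^ 2 / 4) := by
          unfold envelope; gcongr
      _ = √C₁ * Real.exp (a * |u| + -u ^ 2 / 4) := by
          rw [mul_assoc, mul_assoc, ← Real.exp_add, ← Real.exp_add, ha]
          congr 2
          ring
      _ ≤ √C₁ * Real.exp (2 * a ^ 2 + -(1 / 8) * u ^ 2) := by
          refine mul_le_mul_of_nonneg_left (Real.exp_le_exp.2 ?_) (Real.sqrt_nonneg _)
          -- Completing the square gives `a|u| ≤ 2a² + u²/8`, which costs half of the Gaussian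
          -- exponent.
          nlinarith [sq_nonneg (4 * a - |u|), sq_abs u]
      _ = _ := by rw [Real.exp_add, mul_assoc]

/-- The coefficients of `T_m` applied to a generalized function with Fourier transform `φ`. -/
def tmCoeff (m : ℝ → ℝ) (φ : ℝ → ℂ) (n : ℕ) : ℂ :=
  (1 / (2 * Real.pi) : ℂ) * ∫ u : ℝ, (√(m u) : ℂ) * φ u * conj (ft (hermiteFun n) u)

/-- The constant in the bounds for the coefficients. -/
def tmConst (m : ℝ → ℝ) : ℝ := 1 / (2 * Real.pi) * (√(2 * Real.pi) * ∫ u, envelope m u)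

theorem norm_tmCoeff_integrand_le (m : ℝ → ℝ) {φ : ℝ → ℂ} {c : ℝ}
    (hφ : ∀ u, ‖φ u‖ ≤ c * (1 + |u|)) (n : ℕ) (u : ℝ) :
    ‖(√(m u) : ℂ) * φ u * conj (ft (hermiteFun n) u)‖ ≤
      c * (√(2 * Real.pi) * hermiteRate ^ n) * envelope m u := by
  rw [norm_mul, norm_mul, RCLike.norm_conj, Complex.norm_real, Real.norm_eq_abs,
    abs_of_nonneg (Real.sqrt_nonneg _)]
  calc √(m u) * ‖φ u‖ * ‖ft (hermiteFun n) u‖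
      ≤ √(m u) * (c * (1 + |u|)) *
          (√(2 * Real.pi) * hermiteRate ^ n * Real.exp (-u ^ 2 / 4)) := by
        refine mul_le_mul (mul_le_mul_of_nonneg_left (hφ u) (Real.sqrt_nonneg _))
          (norm_ft_hermiteFun_le n u) (norm_nonneg _)
          (mul_nonneg (Real.sqrt_nonneg _) ((norm_nonneg _).trans (hφ u)))
    _ = _ := by unfold envelope; ring

theorem integrable_tmCoeff_integrand {m : ℝ → ℝ} (hm : Measurable m)
    (he : Integrable (envelope m)) {φ : ℝ → ℂ} (hc : Continuous φ) {c : ℝ}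
    (hφ : ∀ u, ‖φ u‖ ≤ c * (1 + |u|)) (n : ℕ) :
    Integrable fun u => (√(m u) : ℂ) * φ u * conj (ft (hermiteFun n) u) := by
  refine (he.const_mul _).mono' ?_ (ae_of_all _ (norm_tmCoeff_integrand_le m hφ n))
  have h1 := hc.measurable
  have h2 := (continuous_ft_hermiteFun n).measurable
  have h3 : Measurable fun u => conj (ft (hermiteFun n) u) :=
    Complex.continuous_conj.measurable.comp h2
  exact Measurable.aestronglyMeasurable (by fun_prop)

theorem norm_tmCoeff_le {m : ℝ → ℝ} (he : Integrable (envelope m)) {φ : ℝ → ℂ} {c : ℝ}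
    (hφ : ∀ u, ‖φ u‖ ≤ c * (1 + |u|)) (n : ℕ) :
    ‖tmCoeff m φ n‖ ≤ c * tmConst m * hermiteRate ^ n := by
  have h := norm_integral_le_of_norm_le (he.const_mul _)
    (ae_of_all _ (norm_tmCoeff_integrand_le m hφ n))
  rw [integral_const_mul] at h
  have e : ‖(1 / (2 * Real.pi) : ℂ)‖ = 1 / (2 * Real.pi) := by
    simp [abs_of_pos Real.pi_pos]
  rw [tmCoeff, norm_mul, e]
  calc _ ≤ 1 / (2 * Real.pi) * (c * (√(2 * Real.pi) * hermiteRate ^ n) * ∫ u, envelope m u) := by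
        gcongr
    _ = _ := by unfold tmConst; ring

theorem norm_ft_indicatorTo_le_mul (t u : ℝ) : ‖ft (indicatorTo t) u‖ ≤ |t| * (1 + |u|) :=
  (norm_ft_indicatorTo_le t u).trans
    (le_mul_of_one_le_right (abs_nonneg t) (by linarith [abs_nonneg u]))

theorem tmIndicator_eq_tmCoeff (m : ℝ → ℝ) (t : ℝ) :
    tmIndicator m t = tmCoeff m (ft (indicatorTo t)) := rfl

theorem integrable_tmDensity {m : ℝ → ℝ} (hm : Measurable m) (he : Integrable (envelope m))
    (t : ℝ) (n : ℕ) : Integrable (tmDensity m t n) :=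
  integrable_tmCoeff_integrand hm he (continuous_ft (integrable_indicatorTo t))
    (norm_ft_indicatorTo_le_mul t) n

theorem norm_tmIndicator_le {m : ℝ → ℝ} (he : Integrable (envelope m)) (t : ℝ) (n : ℕ) :
    ‖tmIndicator m t n‖ ≤ |t| * tmConst m * hermiteRate ^ n :=
  norm_tmCoeff_le he (norm_ft_indicatorTo_le_mul t) n

/-- By linearity in the Fourier side this is one coefficient integral, to which the general bound
applies with `c = |s|`. -/
theorem norm_tmIndicator_diffQuot_le {m : ℝ → ℝ} (hm : Measurable m)
    (he : Integrable (envelope m)) (t s : ℝ) (n : ℕ) (hs : s ≠ 0) :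
    ‖((s⁻¹ : ℝ) : ℂ) * (tmIndicator m (t + s) n - tmIndicator m t n) -
      tmCoeff m (fun u => Complex.exp (-(Complex.I * u * t))) n‖ ≤
      |s| * tmConst m * hermiteRate ^ n := by
  have hs' : (s : ℂ) ≠ 0 := by exact_mod_cast hs
  set ψ : ℝ → ℂ := fun u => Complex.exp (-(Complex.I * u * t))
  have hψc : Continuous ψ := by fun_prop
  have hψ (u : ℝ) : ‖ψ u‖ ≤ 1 * (1 + |u|) := by
    rw [norm_exp_neg_I_mul, one_mul]
    linarith [abs_nonneg u]
  have j1 := integrable_tmCoeff_integrand hm he (continuous_ft (integrable_indicatorTo (t + s)))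
    (norm_ft_indicatorTo_le_mul (t + s)) n
  have j2 := integrable_tmCoeff_integrand hm he (continuous_ft (integrable_indicatorTo t))
    (norm_ft_indicatorTo_le_mul t) n
  have j3 := integrable_tmCoeff_integrand hm he hψc hψ n
  have e : ((s⁻¹ : ℝ) : ℂ) * (tmIndicator m (t + s) n - tmIndicator m t n) - tmCoeff m ψ n =
      tmCoeff m (fun u => ((s⁻¹ : ℝ) : ℂ) *
        (ft (indicatorTo (t + s)) u - ft (indicatorTo t) u - s * ψ u)) n := by
    rw [tmIndicator_eq_tmCoeff, tmIndicator_eq_tmCoeff]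
    simp only [tmCoeff]
    have j4 := (j1.sub j2).const_mul ((s⁻¹ : ℝ) : ℂ)
    simp only [Pi.sub_apply] at j4
    rw [← mul_sub, ← integral_sub j1 j2, mul_left_comm, ← mul_sub, ← integral_const_mul,
      ← integral_sub j4 j3]
    congr 1
    refine integral_congr_ae (ae_of_all _ fun u => ?_)
    push_cast
    field_simp
  rw [e]
  refine norm_tmCoeff_le he (fun u => ?_) n
  rw [norm_mul, Complex.norm_real, Real.norm_eq_abs, abs_inv, inv_mul_le_iff₀ (abs_pos.2 hs)]
  refine (norm_ft_indicatorTo_sub_le t s u).trans ?_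
  have := mul_nonneg (abs_nonneg s) (abs_nonneg s)
  nlinarith

/-- `g` is the inverse transform of `√m` times the transform of the indicator; Parseval then gives
its Hermite coefficients, and the substitution `u = 2πξ` accounts for the factor `1/(2π)`. -/
theorem exists_isTm {m : ℝ → ℝ} (hm : Measurable m) (hm0 : ∀ u, 0 ≤ m u)
    (hint : Integrable fun u : ℝ => m u / (1 + u ^ 2)) (t : ℝ) :
    ∃ f g : Lp ℂ 2 (volume : Measure ℝ), f =ᵐ[volume] indicatorTo t ∧ IsTm m f g ∧
      ∀ n, tmIndicator m t n = ∫ x : ℝ, conj (hermiteFun n x) * g x := by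
  have hpi : (2 * Real.pi) ≠ 0 := by positivity
  let G : ℝ → ℂ := fun ξ =>
    (√(m (2 * Real.pi * ξ)) : ℂ) * ft (indicatorTo t) (2 * Real.pi * ξ)
  have hDc := (continuous_ft (integrable_indicatorTo t)).measurable
  have hGm : AEStronglyMeasurable G volume := Measurable.aestronglyMeasurable (by fun_prop)
  have hG : MemLp G 2 := by
    rw [memLp_two_iff_integrable_sq_norm hGm]
    refine ((hint.comp_mul_left' hpi).const_mul (t ^ 2 + 4)).mono' (hGm.norm.pow 2)
      (ae_of_all _ fun ξ => ?_)
    rw [Real.norm_eq_abs, abs_of_nonneg (by positivity), norm_mul, Complex.norm_real,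
      Real.norm_eq_abs, abs_of_nonneg (Real.sqrt_nonneg _), mul_pow, Real.sq_sqrt (hm0 _)]
    have h := normSq_ft_indicatorTo_le t (2 * Real.pi * ξ)
    rw [← mul_div_assoc, le_div_iff₀ (by positivity)]
    nlinarith [hm0 (2 * Real.pi * ξ)]
  let f : Lp ℂ 2 (volume : Measure ℝ) := (indicatorTo_memLp t 2).toLp _
  let g : Lp ℂ 2 (volume : Measure ℝ) := 𝓕⁻ (hG.toLp G)
  have hgF : 𝓕 g = hG.toLp G := FourierTransform.fourier_fourierInv_eq _
  refine ⟨f, g, MemLp.coeFn_toLp _, ?_, fun n => ?_⟩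
  · unfold IsTm
    rw [hgF]
    filter_upwards [hG.coeFn_toLp,
      fourier_toLp_ae_eq (integrable_indicatorTo t) (indicatorTo_memLp t 2)] with ξ h1 h2
    rw [h1, h2, fourier_eq_ft]
  · let e : Lp ℂ 2 (volume : Measure ℝ) := (memLp_two_hermiteFun n).toLp _
    have h1 : ∫ x : ℝ, conj (hermiteFun n x) * g x = inner ℂ e g := by
      rw [L2.inner_def]
      refine integral_congr_ae ?_
      filter_upwards [(memLp_two_hermiteFun n).coeFn_toLp] with x hx
      rw [RCLike.inner_apply, hx, mul_comm]
    have h2 : inner ℂ (𝓕 e) (𝓕 g) = ∫ ξ : ℝ, tmDensity m t n (2 * Real.pi * ξ) := by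
      rw [hgF, L2.inner_def]
      refine integral_congr_ae ?_
      filter_upwards [hG.coeFn_toLp,
        fourier_toLp_ae_eq (integrable_hermiteFun n) (memLp_two_hermiteFun n)] with ξ k1 k2
      rw [RCLike.inner_apply, k1, k2, fourier_eq_ft]
      rfl
    rw [h1, ← Lp.inner_fourier_eq, h2, Measure.integral_comp_mul_left, tmIndicator,
      abs_of_nonneg (by positivity), Complex.real_smul]
    congr 1
    push_cast
    rw [one_div]

end FreeNoise

end

theorem theorem8p4 (m : ℝ → ℝ) (hm : Measurable m) (hm0 : ∀ u, 0 ≤ m u)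
    (b K C₁ C₂ : ℝ) (hb : b < 2) (hC₁ : 0 < C₁) (hC₂ : 0 < C₂)
    (hsmall : ∀ t : ℝ, t ≠ 0 → |t| ≤ 1 → m t ≤ K * |t| ^ (-b))
    (hlarge : ∀ t : ℝ, 1 ≤ |t| → m t ≤ C₁ * Real.exp (C₂ * |t|)) :
    -- `T_m 1_{[0,t]}` is well defined, and belongs to `K_{-p}` for some `p`
    (∀ t n, Integrable (FreeNoise.tmDensity m t n)) ∧
    (∀ t, ∃ p : ℕ, FreeNoise.tmIndicator m t ∈ FreeNoise.K (-(p : ℤ))) ∧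
    -- it is the value of the operator `T_m` of `L²(ℝ)` at `1_{[0,t]}` if `∫ m(u)/(1+u²) du < ∞`
    (Integrable (fun u : ℝ => m u / (1 + u ^ 2)) →
      ∀ t, ∃ f g : Lp ℂ 2 (volume : Measure ℝ), f =ᵐ[volume] FreeNoise.indicatorTo t ∧
        FreeNoise.IsTm m f g ∧
        ∀ n, FreeNoise.tmIndicator m t n = ∫ x : ℝ, conj (FreeNoise.hermiteFun n x) * g x) ∧
    -- the process `X_m` and its derivative `W_m`
    ∃ X W : ℝ → (FreeNoise.G1 →L[ℂ] FreeNoise.Gm1),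
      (∀ t f, (X t f).coeff = FreeNoise.freeField (FreeNoise.tmIndicator m t) f.coeff) ∧
      ∀ t f, Tendsto (fun h : ℝ => (h : ℂ)⁻¹ • (X (t + h) f - X t f)) (𝓝[≠] 0) (𝓝 (W t f)) := by
  have he := FreeNoise.integrable_envelope hm hb hm0 hC₁ hsmall hlarge
  refine ⟨FreeNoise.integrable_tmDensity hm he, fun t => ?_, FreeNoise.exists_isTm hm hm0, ?_⟩
  · obtain ⟨p, hp⟩ :=
      pow_unbounded_of_one_lt (2 * FreeNoise.hermiteRate ^ 2) (one_lt_two : (1 : ℝ) < 2)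
    exact ⟨p, (FreeNoise.geometric_mem_K hp.le (FreeNoise.norm_tmIndicator_le he t)).1⟩
  · refine FreeNoise.exists_field_derivative
      -- The vector of `W_m(t)` is formally `T_m δ_t`, since `δ_t` has Fourier transform `e^{-iut}`.
      (h' := fun t => FreeNoise.tmCoeff m fun u => Complex.exp (-(Complex.I * u * t)))
      (FreeNoise.norm_tmIndicator_le he) (fun t n => ?_)
      (fun t s n hs => FreeNoise.norm_tmIndicator_diffQuot_le hm he t s n hs)
    -- Exposes `c = 1` in the coefficient bound, as `|e^{-iut}| = 1 ≤ 1 + |u|`.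
    rw [← one_mul (FreeNoise.tmConst m)]
    refine FreeNoise.norm_tmCoeff_le he (fun u => ?_) n
    rw [FreeNoise.norm_exp_neg_I_mul, one_mul]
    linarith [abs_nonneg u]
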